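/- Conventions. A monoid is a commutative monoid with an identity $1$ and an absorbing element $0$; $\mathfrak M_0$ is the category of monoids, with maps preserving products, $1$ and $0$. For an abelian group $G$ put $\mathbb F_1[G]:=G\cup\{0\}$. Ideals of a monoid contain $0$. The prime spectrum $\operatorname{spec}M$ of a monoid, with its Zariski topology and structure sheaf, is defined as for rings; a monoid scheme is a space with a sheaf of monoids that is locally isomorphic to such spectra, and morphisms of monoid schemes are required to be local on stalks. Let $\beta^*\colon\mathfrak{CRing}\to\mathfrak M_0$ be the functor forgetting addition, and let $\mathfrak{MR}$ be the category with objects $\mathrm{Ob}(\mathfrak M_0)\sqcup\mathrm{Ob}(\mathfrak{CRing})$, containing both as full subcategories, with $\operatorname{Hom}(M,R)=\operatorname{Hom}_{\mathfrak M_0}(M,\beta^*R)$ and $\operatorname{Hom}(R,M)=\emptyset$ for a monoid $M$ and a ring $R$. A subfunctor $\mathcal G$ of $\mathcal F\colon\mathfrak M_0\to\mathfrak{Set}$ is open if for every monoid $M$ and every $\varphi\colon\operatorname{Hom}(M,\cdot)\to\mathcal F$ there is an ideal $\mathfrak a\subset M$ such that $\varphi_N(\rho)\in\mathcal G(N)\iff\rho(\mathfrak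 a)N=N$ for all $\rho\colon M\to N$. The functor $\mathcal F$ is an $\mathfrak M_0$-scheme if it has a family of open representable subfunctors $\mathcal F_i$ with $\mathcal F(\mathbb F_1[G])=\bigcup_i\mathcal F_i(\mathbb F_1[G])$ for all abelian groups $G$; it is Noetherian if it is the union of finitely many (at least one) open subfunctors $\operatorname{Hom}(M_i,\cdot)$ with $M_i$ finitely generated. Its geometric realisation is the monoid scheme $X$ with $\mathcal F\cong\operatorname{Hom}(\operatorname{spec}(\cdot),X)$. A $\mathbb Z$-scheme is a functor $\mathfrak{CRing}\to\mathfrak{Set}$ isomorphic to $\operatorname{Hom}(\operatorname{Spec}(\cdot),X)$ for a scheme $X$, and it is Noetherian if $X$ is. An $\mathbb F_1$-scheme is a functor $\mathcal X\colon\mathfrak{MR}\to\mathfrak{Set}$ such that $\mathcal X|_{\mathfrak M_0}$ is an $\mathfrak M_0$-scheme, $\mathcal X|_{\mathfrak{CRing}}$ is a $\mathbb Z$-scheme, and the map $\mathcal X(\beta^*K)\to\mathcal X(K)$ induced by $\mathrm{id}_{\beta^*K}$ is bijective for every field $K$. It is Noetherian if both restrictions are, and torsion free if the geometric realisation $X$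 of $\mathcal X|_{\mathfrak M_0}$ has torsion free unit groups $\mathcal O_{X,x}^\times$ for all $x\in X$. Theorem. Let $\mathcal X$ be a torsion free Noetherian $\mathbb F_1$-scheme. (1) $\mathcal X$ has a unique counting function, that is, there is a unique $N(t)\in\mathbb Z[t]$ such that $\#\mathcal X(\mathbb F_1[C])=N(n+1)$ for every $n\ge 1$ and every cyclic group $C$ of order $n$, and $\#\mathcal X(\mathbb F_q)=N(q)$ for every finite field $\mathbb F_q$ (in particular these sets are finite). (2) $\mathcal X$ has an absolute zeta function, that is, for real $s>\deg N$ the series below converges for all $p>1$, and there is a unique meromorphic function $\zeta_{\mathcal X/\mathbb F_1}$ on $\mathbb C$ with $$\zeta_{\mathcal X/\mathbb F_1}(s)=\lim_{p\to1^+}(p-1)^{N(1)}\exp\left(\sum_{m=1}^\infty\frac{N(p^m)}{m}p^{-sm}\right)\qquad(s\in\mathbb R,\ s>\deg N).$$ (3) Put $\kappa_a(n):=\frac1n\sum_{m\mid n}\mu\left(\frac nm\right)a^m$ for $a\in\mathbb Z$, $n\ge1$, and let $M_n\colon\mathbb Z[t]\to\bigoplus_{a\in\mathbb Z}\mathbb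 Z\kappa_a(n)$ be the $\mathbb Z$-linear map with $M_n(t^a)=\kappa_a(n)$ (the linear Möbius transform). Read as a number (the sum of its components), $M_n(N(t))$ is an integer for every $n\ge1$, and for every $s\in\mathbb C$ with $|s|>\deg N$ $$\zeta_{\mathcal X/\mathbb F_1}(s)=\left(\frac1s\right)^{N(1)}\prod_{n=1}^\infty\left(1-\left(\frac1s\right)^n\right)^{-M_n(N(t))},$$ where the product converges absolutely, i.e. $\sum_{n\ge1}\left|\left(1-(1/s)^n\right)^{-M_n(N(t))}-1\right|<\infty$. Here $\deg N:=0$ if $N=0$. -/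

import Mathlib

open CategoryTheory Opposite TopologicalSpace Filter Topology
open scoped Polynomial DirectSum

universe u

noncomputable section

namespace FOne

/-! ### Commutative monoids with an absorbing element -/

/-- The category of commutative monoids with identity `1` and absorbing element `0`;
morphisms preserve products, `1` and `0`. -/
structure M0 : Type (u + 1) where
  of ::
  carrier : Type u
  [str : CommMonoidWithZero carrier]

attribute [instance] M0.str

instance : CoeSort M0.{u} (Type u) := ⟨M0.carrier⟩

instance : LargeCategory.{u} M0.{u} where
  Hom M N := M →*₀ N
  id M := MonoidWithZeroHom.id M
  comp f g := g.comp f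

instance : ConcreteCategory M0.{u} (fun M N => M →*₀ N) where
  hom f := f
  ofHom f := f

/-- `𝔽₁[G] = G ∪ {0}` for an abelian group `G`. -/
def F1of (G : Type u) [CommGroup G] : M0.{u} := M0.of (WithZero G)

/-- The functor `β*` that forgets the addition of a commutative ring. -/
def betaStar : CommRingCat.{u} ⥤ M0.{u} where
  obj R := M0.of R
  map {R S} f := (f.hom.toMonoidWithZeroHom : R →*₀ S)
  map_id _ := rfl
  map_comp _ _ := rfl

/-- An ideal of a monoid `M`: a subset containing `0` with `𝔞 M ⊆ 𝔞`. -/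
structure MIdeal (M : Type u) [CommMonoidWithZero M] where
  carrier : Set M
  zero_mem : 0 ∈ carrier
  mul_mem : ∀ a ∈ carrier, ∀ m : M, a * m ∈ carrier

/-- A point of `spec M`: a proper ideal whose complement is multiplicatively closed. -/
@[ext]
structure PrimeIdeal (M : Type u) [CommMonoidWithZero M] where
  carrier : Set M
  zero_mem : 0 ∈ carrier
  mul_mem : ∀ a ∈ carrier, ∀ m : M, a * m ∈ carrier
  ne_univ : carrier ≠ Set.univ
  prime : ∀ a b : M, a ∉ carrier → b ∉ carrier → a * b ∉ carrier

namespace PrimeIdeal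

variable {M N : Type u} [CommMonoidWithZero M] [CommMonoidWithZero N]

theorem one_notMem (p : PrimeIdeal M) : (1 : M) ∉ p.carrier := fun h =>
  p.ne_univ (Set.eq_univ_of_forall fun m => by simpa using p.mul_mem 1 h m)

/-- The complement `M ∖ 𝔭`. -/
def compl (p : PrimeIdeal M) : Submonoid M where
  carrier := p.carrierᶜ
  one_mem' := p.one_notMem
  mul_mem' := fun ha hb => p.prime _ _ ha hb

/-- The localisation `M_𝔭 = (M ∖ 𝔭)⁻¹ M`. -/
abbrev Loc (p : PrimeIdeal M) : Type u := Localization p.compl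

/-- The closed set `V(𝔞)`. -/
def V (a : MIdeal M) : Set (PrimeIdeal M) := {p | a.carrier ⊆ p.carrier}

/-- The Zariski topology: the closed sets are the sets `V(𝔞)`. -/
instance : TopologicalSpace (PrimeIdeal M) :=
  TopologicalSpace.ofClosed (Set.range (V (M := M)))
    ⟨⟨Set.univ, trivial, fun _ _ _ => trivial⟩, by
      ext p
      simp only [V, Set.mem_ofPred_eq, Set.mem_empty_iff_false, iff_false]
      exact fun h => p.one_notMem (h trivial)⟩
    (by
      intro A hA
      refine ⟨⟨{m | m = 0 ∨ ∃ a : MIdeal M, V a ∈ A ∧ m ∈ a.carrier}, Or.inl rfl, ?_⟩, ?_⟩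
      · rintro _ (rfl | ⟨a, ha, hx⟩) m
        · exact Or.inl (zero_mul m)
        · exact Or.inr ⟨a, ha, a.mul_mem _ hx m⟩
      · ext p
        simp only [V, Set.mem_ofPred_eq, Set.mem_sInter]
        constructor
        · intro h t ht
          obtain ⟨a, rfl⟩ := hA ht
          exact fun m hm => h (Or.inr ⟨a, ht, hm⟩)
        · rintro h m (rfl | ⟨a, ha, hm⟩)
          · exact p.zero_mem
          · exact h _ ha hm)
    (by
      rintro _ ⟨a, rfl⟩ _ ⟨b, rfl⟩
      refine ⟨⟨a.carrier ∩ b.carrier, ⟨a.zero_mem, b.zero_mem⟩,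
        fun x hx m => ⟨a.mul_mem x hx.1 m, b.mul_mem x hx.2 m⟩⟩, ?_⟩
      ext p
      simp only [V, Set.mem_ofPred_eq, Set.mem_union]
      constructor
      · intro h
        by_contra hc
        push Not at hc
        obtain ⟨⟨x, hxa, hx⟩, ⟨y, hyb, hy⟩⟩ :=
          (⟨Set.not_subset.1 hc.1, Set.not_subset.1 hc.2⟩ :
            (∃ x ∈ a.carrier, x ∉ p.carrier) ∧ (∃ y ∈ b.carrier, y ∉ p.carrier))
        refine p.prime x y hx hy (h ⟨a.mul_mem x hxa y, ?_⟩)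
        rw [mul_comm]
        exact b.mul_mem y hyb x
      · rintro (h | h) x hx
        · exact h hx.1
        · exact h hx.2)

theorem isClosed_V (a : MIdeal M) : IsClosed (V a) := by
  rw [← isOpen_compl_iff]
  show (V a)ᶜᶜ ∈ Set.range (V (M := M))
  rw [compl_compl]
  exact ⟨a, rfl⟩

/-- The contraction of a prime ideal along a morphism. -/
def comap (f : M →*₀ N) (p : PrimeIdeal N) : PrimeIdeal M where
  carrier := f ⁻¹' p.carrier
  zero_mem := by simpa using p.zero_mem
  mul_mem a ha m := by
    simp only [Set.mem_preimage, map_mul] at ha ⊢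
    exact p.mul_mem _ ha _
  ne_univ h := p.one_notMem (by
    have : (1 : M) ∈ f ⁻¹' p.carrier := h ▸ trivial
    simpa using this)
  prime a b ha hb := by
    simp only [Set.mem_preimage, map_mul] at ha hb ⊢
    exact p.prime _ _ ha hb

theorem continuous_comap (f : M →*₀ N) : Continuous (comap f) := by
  rw [continuous_iff_isClosed]
  intro s hs
  rw [← isOpen_compl_iff] at hs
  change sᶜᶜ ∈ Set.range (V (M := M)) at hs
  rw [compl_compl] at hs
  obtain ⟨a, rfl⟩ := hs
  have : comap f ⁻¹' V a = V ⟨{n | n = 0 ∨ ∃ m ∈ a.carrier, ∃ k, n = f m * k}, Or.inl rfl, by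
      rintro _ (rfl | ⟨m, hm, k, rfl⟩) l
      · exact Or.inl (zero_mul l)
      · exact Or.inr ⟨m, hm, k * l, mul_assoc _ _ _⟩⟩ := by
    ext p
    simp only [Set.mem_preimage, V, Set.mem_ofPred_eq]
    constructor
    · rintro h n (rfl | ⟨m, hm, k, rfl⟩)
      · exact p.zero_mem
      · exact p.mul_mem _ (h hm) _
    · intro h m hm
      exact h (Or.inr ⟨m, hm, 1, (mul_one _).symm⟩)
  rw [this]
  exact isClosed_V _

/-- The map `M_{f⁻¹ 𝔭} → N_𝔭` induced by `f`. -/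
def locMap (f : M →*₀ N) (p : PrimeIdeal N) : (comap f p).Loc →* p.Loc :=
  Submonoid.LocalizationMap.map (Localization.monoidOf (comap f p).compl)
    (g := (f : M →* N)) (T := p.compl) (fun y => y.2) (Localization.monoidOf p.compl)

theorem locMap_mk (f : M →*₀ N) (p : PrimeIdeal N) (a : M) (s : (comap f p).compl) :
    locMap f p (Localization.mk a s) = Localization.mk (f a) ⟨f s, s.2⟩ := by
  rw [Localization.mk_eq_monoidOf_mk', Localization.mk_eq_monoidOf_mk']
  exact Submonoid.LocalizationMap.map_mk' _ _ _ _

end PrimeIdeal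

/-! ### Monoidal spaces -/

/-- A monoidal space: a topological space with a sheaf of monoids. -/
structure MonoidalSpace : Type (u + 1) where
  carrier : Type u
  [top : TopologicalSpace carrier]
  /-- sections over open sets -/
  sec : Opens carrier → Type u
  [monoid : ∀ U, CommMonoidWithZero (sec U)]
  /-- restriction maps -/
  res : ∀ {U V : Opens carrier}, U ≤ V → sec V →*₀ sec U
  res_id : ∀ (U : Opens carrier) (s : sec U), res le_rfl s = s
  res_res : ∀ {U V W : Opens carrier} (h : U ≤ V) (h' : V ≤ W) (s : sec W),
    res h (res h' s) = res (h.trans h') s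
  /-- the sheaf axiom -/
  glue : ∀ {ι : Type u} (U : ι → Opens carrier) (s : ∀ i, sec (U i)),
    (∀ i j, res (inf_le_left : U i ⊓ U j ≤ U i) (s i) =
      res (inf_le_right : U i ⊓ U j ≤ U j) (s j)) →
    ∃! t : sec (⨆ i, U i), ∀ i, res (le_iSup U i) t = s i

attribute [instance] MonoidalSpace.top MonoidalSpace.monoid

namespace MonoidalSpace

/-- Sections over the open neighbourhoods of a point, ordered by reverse inclusion. -/
abbrev SecAt (X : MonoidalSpace.{u}) (x : X.carrier) (U : (OpenNhdsOf x)ᵒᵈ) : Type u :=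
  X.sec (OrderDual.ofDual U).toOpens

/-- The restriction maps between sections over neighbourhoods of a point. -/
abbrev resAt (X : MonoidalSpace.{u}) (x : X.carrier) :
    ∀ (U V : (OpenNhdsOf x)ᵒᵈ), U ≤ V → X.SecAt x U →*₀ X.SecAt x V :=
  fun _ _ h => X.res h

instance (X : MonoidalSpace.{u}) (x : X.carrier) :
    DirectedSystem (X.SecAt x) (X.resAt x · · ·) where
  map_self _ s := X.res_id _ s
  map_map _ _ _ _ _ s := X.res_res _ _ s

/-- The stalk `𝒪_{X,x}`, the direct limit of the sections over the open neighbourhoods of `x`. -/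
abbrev Stalk (X : MonoidalSpace.{u}) (x : X.carrier) : Type u :=
  DirectLimit (X.SecAt x) (X.resAt x)

/-- The germ of a section at a point. -/
def germ (X : MonoidalSpace.{u}) (x : X.carrier) {U : Opens X.carrier} (hx : x ∈ U)
    (s : X.sec U) : X.Stalk x :=
  ⟦⟨OrderDual.toDual (⟨U, hx⟩ : OpenNhdsOf x), s⟩⟧

theorem isUnit_germ_iff (X : MonoidalSpace.{u}) (x : X.carrier) {U : Opens X.carrier} (hx : x ∈ U)
    (s : X.sec U) : IsUnit (X.germ x hx s) ↔
      ∃ (W : Opens X.carrier) (hW : W ≤ U) (_ : x ∈ W) (t : X.sec W), X.res hW s * t = 1 := by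
  have hres : ∀ (W : Opens X.carrier) (hW : W ≤ U) (hxW : x ∈ W),
      X.germ x hxW (X.res hW s) = X.germ x hx s := fun W hW hxW =>
    DirectLimit.mk_apply (f := X.resAt x) (OrderDual.toDual (⟨U, hx⟩ : OpenNhdsOf x))
      (OrderDual.toDual (⟨W, hxW⟩ : OpenNhdsOf x))
      (show X.SecAt x (OrderDual.toDual (⟨U, hx⟩ : OpenNhdsOf x)) from s) hW
  constructor
  · intro h
    obtain ⟨y, hy⟩ := h.exists_right_inv
    obtain ⟨W, t, rfl⟩ := DirectLimit.exists_eq_mk (X.resAt x) y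
    let W' : Opens X.carrier := U ⊓ (OrderDual.ofDual W).toOpens
    have hxW' : x ∈ W' := ⟨hx, (OrderDual.ofDual W).mem⟩
    let w : (OpenNhdsOf x)ᵒᵈ := OrderDual.toDual ⟨W', hxW'⟩
    have hWw : W ≤ w := show W' ≤ (OrderDual.ofDual W).toOpens from inf_le_right
    have ht : (⟦⟨W, t⟩⟧ : X.Stalk x) = ⟦⟨w, X.resAt x W w hWw t⟩⟧ :=
      (DirectLimit.mk_apply (f := X.resAt x) W w t hWw).symm
    rw [← hres W' inf_le_left hxW', ht] at hy
    have hm := (DirectLimit.mul_def (f := X.resAt x) w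
      (show X.SecAt x w from X.res inf_le_left s)
      (X.resAt x W w hWw t)).symm.trans (Eq.trans hy (DirectLimit.one_def (f := X.resAt x) w))
    obtain ⟨v, hv, _, e⟩ := Quotient.exact hm
    have hv' : (OrderDual.ofDual v).toOpens ≤ W' := hv
    refine ⟨(OrderDual.ofDual v).toOpens, hv'.trans inf_le_left,
      (OrderDual.ofDual v).mem, X.res hv' (X.resAt x W w hWw t), ?_⟩
    refine (congrArg (· * _) (X.res_res hv' inf_le_left s).symm).trans ?_
    exact (map_mul (X.res hv') _ _).symm.trans (Eq.trans e (map_one (X.res hv')))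
  · rintro ⟨W, hW, hxW, t, h⟩
    rw [← hres W hW hxW]
    refine IsUnit.of_mul_eq_one (X.germ x hxW t) ?_
    refine (DirectLimit.mul_def (f := X.resAt x)
      (OrderDual.toDual (⟨W, hxW⟩ : OpenNhdsOf x)) (X.res hW s) t).trans ?_
    exact (congrArg (X.germ x hxW) h).trans (DirectLimit.one_def (f := X.resAt x) _).symm

/-- The preimage of an open set under a continuous map. -/
abbrev pre {X Y : Type u} [TopologicalSpace X] [TopologicalSpace Y] {f : X → Y} (hf : Continuous f)
    (V : Opens Y) : Opens X := ⟨f ⁻¹' V, V.2.preimage hf⟩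

/-- A (local) morphism of monoidal spaces: a continuous map `f` with a morphism
`f^# : 𝒪_Y → f_* 𝒪_X` of sheaves of monoids such that all the induced maps
`𝒪_{Y, f x} → 𝒪_{X, x}` on stalks are local. -/
structure Hom (X Y : MonoidalSpace.{u}) : Type u where
  base : X.carrier → Y.carrier
  cont : Continuous base
  app : ∀ V : Opens Y.carrier, Y.sec V →*₀ X.sec (pre cont V)
  naturality : ∀ {U V : Opens Y.carrier} (h : U ≤ V) (s : Y.sec V),
    app U (Y.res h s) = X.res (fun _ hx => h hx) (app V s)
  isLocal : ∀ (x : X.carrier) (V : Opens Y.carrier) (hx : base x ∈ V) (s : Y.sec V),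
    IsUnit (X.germ x (U := pre cont V) hx (app V s)) → IsUnit (Y.germ (base x) hx s)

theorem Hom.ext' {X Y : MonoidalSpace.{u}} {f g : Hom X Y} (h : ∀ x, f.base x = g.base x)
    (h' : ∀ (V : Opens Y.carrier) (s : Y.sec V),
      X.res (fun x hx => by
        change f.base x ∈ V; rw [h]; exact hx) (f.app V s) = g.app V s) : f = g := by
  obtain ⟨fb, fc, fa, fn, fl⟩ := f
  obtain ⟨gb, gc, ga, gn, gl⟩ := g
  obtain rfl : fb = gb := funext h
  have : fa = ga := by
    funext V
    ext s
    rw [← h' V s]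
    exact (X.res_id _ _).symm
  subst this
  rfl

/-- The category of monoidal spaces and local morphisms. -/
instance : LargeCategory.{u} MonoidalSpace.{u} where
  Hom := Hom
  id X :=
    { base := id
      cont := continuous_id
      app := fun _ => MonoidWithZeroHom.id _
      naturality := fun _ _ => rfl
      isLocal := fun _ _ _ _ h => h }
  comp f g :=
    { base := g.base ∘ f.base
      cont := g.cont.comp f.cont
      app := fun V => (f.app (pre g.cont V)).comp (g.app V)
      naturality := fun {U V} h s =>
        (congrArg (f.app (pre g.cont U)) (g.naturality h s)).trans
          (f.naturality (U := pre g.cont U) (V := pre g.cont V) (fun _ hx => h hx) _)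
      isLocal := fun x V hx s h =>
        g.isLocal (f.base x) V hx s (f.isLocal x (pre g.cont V) hx _ h) }

/-- The image in `X` of an open subset of an open subset `U` of `X`. -/
def img {X : Type u} [TopologicalSpace X] {U : Opens X} (V : Opens U) : Opens X :=
  ⟨Subtype.val '' (V : Set U), U.2.isOpenMap_subtype_val _ V.2⟩

theorem img_mono {X : Type u} [TopologicalSpace X] {U : Opens X} {V W : Opens U} (h : V ≤ W) :
    img V ≤ img W := Set.image_mono h

/-- The open subspace `(U, 𝒪_X|_U)`. -/
def restrict (X : MonoidalSpace.{u}) (U : Opens X.carrier) : MonoidalSpace.{u} where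
  carrier := U
  sec V := X.sec (img V)
  res h := X.res (img_mono h)
  res_id _ s := X.res_id _ s
  res_res _ _ s := X.res_res _ _ s
  glue {ι} W s hs := by
    have e : img (⨆ i, W i) = ⨆ i, img (W i) := by
      ext x
      simp only [img, Opens.coe_mk, Opens.coe_iSup, Set.image_iUnion]
    obtain ⟨t, ht, hu⟩ := X.glue (fun i => img (W i)) s (fun i j => by
      have h : img (W i) ⊓ img (W j) ≤ img (W i ⊓ W j) := by
        rintro _ ⟨⟨a, ha, rfl⟩, ⟨b, hb, hab⟩⟩
        obtain rfl : b = a := Subtype.ext hab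
        exact ⟨b, ⟨ha, hb⟩, rfl⟩
      have := congrArg (X.res h) (hs i j)
      rwa [X.res_res, X.res_res] at this)
    refine ⟨X.res e.le t, fun i => ?_, fun t' ht' => ?_⟩
    · show X.res _ (X.res _ t) = _
      rw [X.res_res, ← ht i]
    · have := hu (X.res e.ge t') (fun i => by
        show X.res _ (X.res _ t') = _
        rw [X.res_res, ← ht' i])
      rw [← this, X.res_res, X.res_id]

end MonoidalSpace

/-! ### The spectrum of a monoid and monoid schemes -/

section spec

variable {M : Type u} [CommMonoidWithZero M]

/-- `s` is near every point of `U` of the form `a / f` with fixed `a, f ∈ M`. -/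
def IsLocFrac {U : Opens (PrimeIdeal M)} (s : ∀ p : U, p.1.Loc) : Prop :=
  ∀ p : U, ∃ V : Opens (PrimeIdeal M), p.1 ∈ V ∧ ∃ hVU : V ≤ U, ∃ a f : M,
    ∀ q (hq : q ∈ V), ∃ hf : f ∈ q.compl, s ⟨q, hVU hq⟩ = Localization.mk a ⟨f, hf⟩

/-- The sections of the structure sheaf of `spec M`. -/
@[ext]
structure SpecSec (M : Type u) [CommMonoidWithZero M] (U : Opens (PrimeIdeal M)) : Type u where
  val : ∀ p : U, p.1.Loc
  isLocFrac : IsLocFrac val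

namespace SpecSec

variable {U V : Opens (PrimeIdeal M)}

theorem ext' {s t : SpecSec M U} (h : ∀ p, s.1 p = t.1 p) : s = t := SpecSec.ext (funext h)

/-- The section `a / 1`. -/
def const (U : Opens (PrimeIdeal M)) (a : M) : SpecSec M U :=
  ⟨fun _ => Localization.mk a 1, fun p => ⟨U, p.2, le_rfl, a, 1,
    fun q _ => ⟨q.one_notMem, rfl⟩⟩⟩

instance : Mul (SpecSec M U) := ⟨fun s t => ⟨fun p => s.1 p * t.1 p, fun p => by
  obtain ⟨V, hpV, hVU, a, f, h⟩ := s.2 p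
  obtain ⟨W, hpW, hWU, b, g, h'⟩ := t.2 p
  refine ⟨V ⊓ W, ⟨hpV, hpW⟩, inf_le_left.trans hVU, a * b, f * g, fun q hq => ?_⟩
  obtain ⟨hf, e⟩ := h q hq.1
  obtain ⟨hg, e'⟩ := h' q hq.2
  exact ⟨q.compl.mul_mem hf hg,
    (congrArg₂ (· * ·) e e').trans (Localization.mk_mul a b ⟨f, hf⟩ ⟨g, hg⟩)⟩⟩⟩

instance : One (SpecSec M U) := ⟨const U 1⟩

instance : Zero (SpecSec M U) := ⟨const U 0⟩

theorem mul_apply (s t : SpecSec M U) (p : U) : (s * t).1 p = s.1 p * t.1 p := rfl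

theorem one_apply (p : U) : (1 : SpecSec M U).1 p = 1 := Localization.mk_one

theorem zero_apply (p : U) : (0 : SpecSec M U).1 p = 0 := Localization.mk_zero _

instance : CommMonoidWithZero (SpecSec M U) where
  mul_assoc a b c := by refine ext' fun p => ?_; simp only [mul_apply, mul_assoc]
  one_mul a := by refine ext' fun p => ?_; simp only [mul_apply, one_apply, one_mul]
  mul_one a := by refine ext' fun p => ?_; simp only [mul_apply, one_apply, mul_one]
  zero_mul a := by refine ext' fun p => ?_; simp only [mul_apply, zero_apply, zero_mul]
  mul_zero a := by refine ext' fun p => ?_; simp only [mul_apply, zero_apply, mul_zero]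
  mul_comm a b := by refine ext' fun p => ?_; simp only [mul_apply, mul_comm]

/-- Restriction of sections. -/
def res (h : U ≤ V) : SpecSec M V →*₀ SpecSec M U where
  toFun s := ⟨fun p => s.1 ⟨p.1, h p.2⟩, fun p => by
    obtain ⟨W, hpW, hWV, a, f, e⟩ := s.2 ⟨p.1, h p.2⟩
    exact ⟨W ⊓ U, ⟨hpW, p.2⟩, inf_le_right, a, f, fun q hq => e q hq.1⟩⟩
  map_zero' := rfl
  map_one' := rfl
  map_mul' _ _ := rfl

end SpecSec

/-- The monoidal space `spec M` with its structure sheaf. -/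
def specObj (M : M0.{u}) : MonoidalSpace.{u} where
  carrier := PrimeIdeal M
  sec U := SpecSec M U
  res h := SpecSec.res h
  res_id _ _ := rfl
  res_res _ _ _ := rfl
  glue {ι} U s hs := by
    have key : ∀ (i j : ι) (p : PrimeIdeal M) (hi : p ∈ U i) (hj : p ∈ U j),
        (s i).1 ⟨p, hi⟩ = (s j).1 ⟨p, hj⟩ := fun i j p hi hj =>
      congrFun (congrArg SpecSec.val (hs i j)) ⟨p, ⟨hi, hj⟩⟩
    have hex : ∀ p : (⨆ i, U i : Opens (PrimeIdeal M)), ∃ i, p.1 ∈ U i := fun p =>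
      Opens.mem_iSup.1 p.2
    choose c hc using hex
    refine ⟨⟨fun p => (s (c p)).1 ⟨p.1, hc p⟩, fun p => ?_⟩, fun i => ?_, fun t ht => ?_⟩
    · obtain ⟨W, hpW, hWU, a, f, e⟩ := (s (c p)).2 ⟨p.1, hc p⟩
      refine ⟨W, hpW, hWU.trans (le_iSup U _), a, f, fun q hq => ?_⟩
      obtain ⟨hf, e'⟩ := e q hq
      exact ⟨hf, Eq.trans (key (c ⟨q, _⟩) (c p) q (hc ⟨q, _⟩) (hWU hq)) e'⟩
    · refine SpecSec.ext' fun p => ?_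
      exact key _ _ p.1 _ p.2
    · refine SpecSec.ext' fun p => ?_
      have := congrFun (congrArg SpecSec.val (ht (c p))) ⟨p.1, hc p⟩
      exact this

/-- The pull-back of sections along a morphism of monoids. -/
def SpecSec.pull {M N : Type u} [CommMonoidWithZero M] [CommMonoidWithZero N] (f : M →*₀ N)
    (V : Opens (PrimeIdeal M)) :
    SpecSec M V →*₀ SpecSec N (MonoidalSpace.pre (PrimeIdeal.continuous_comap f) V) where
  toFun s := ⟨fun p => PrimeIdeal.locMap f p.1 (s.1 ⟨PrimeIdeal.comap f p.1, p.2⟩), fun p => by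
    obtain ⟨W, hpW, hWV, a, b, e⟩ := s.2 ⟨PrimeIdeal.comap f p.1, p.2⟩
    refine ⟨MonoidalSpace.pre (PrimeIdeal.continuous_comap f) W, hpW, fun q hq => hWV hq,
      f a, f b, fun q hq => ?_⟩
    obtain ⟨hb, e'⟩ := e _ hq
    exact ⟨hb, (congrArg (PrimeIdeal.locMap f q) e').trans (PrimeIdeal.locMap_mk f q a ⟨b, hb⟩)⟩⟩
  map_zero' := by
    refine SpecSec.ext' fun p => ?_
    show PrimeIdeal.locMap f p.1 (Localization.mk 0 1) = Localization.mk 0 1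
    rw [PrimeIdeal.locMap_mk, map_zero, Localization.mk_zero, Localization.mk_zero]
  map_one' := by
    refine SpecSec.ext' fun p => ?_
    show PrimeIdeal.locMap f p.1 (Localization.mk 1 1) = Localization.mk 1 1
    rw [Localization.mk_one, map_one, Localization.mk_one]
  map_mul' s t := by
    refine SpecSec.ext' fun p => ?_
    exact map_mul (PrimeIdeal.locMap f p.1) _ _

end spec

theorem PrimeIdeal.locMap_id {M : Type u} [CommMonoidWithZero M] (p : PrimeIdeal M) (x : p.Loc) :
    PrimeIdeal.locMap (MonoidWithZeroHom.id M) p x = x := by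
  induction x using Localization.induction_on with
  | H y => exact PrimeIdeal.locMap_mk (MonoidWithZeroHom.id M) p y.1 y.2

theorem PrimeIdeal.locMap_comp {L M N : Type u} [CommMonoidWithZero L] [CommMonoidWithZero M]
    [CommMonoidWithZero N] (f : L →*₀ M) (g : M →*₀ N) (p : PrimeIdeal N)
    (x : (PrimeIdeal.comap (g.comp f) p).Loc) :
    PrimeIdeal.locMap (g.comp f) p x =
      PrimeIdeal.locMap g p (PrimeIdeal.locMap f (PrimeIdeal.comap g p) x) := by
  induction x using Localization.induction_on with
  | H y =>
    refine (PrimeIdeal.locMap_mk (g.comp f) p y.1 y.2).trans ?_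
    refine Eq.trans ?_ (congrArg (PrimeIdeal.locMap g p)
      (PrimeIdeal.locMap_mk f (PrimeIdeal.comap g p) y.1 y.2)).symm
    exact (PrimeIdeal.locMap_mk g p (f y.1) ⟨f y.2, y.2.2⟩).symm

theorem PrimeIdeal.notMem_of_isUnit {M : Type u} [CommMonoidWithZero M] (p : PrimeIdeal M) (a : M)
    (s : p.compl) (h : IsUnit (Localization.mk a s : p.Loc)) : a ∈ p.compl := by
  obtain ⟨y, hy⟩ := h.exists_right_inv
  induction y using Localization.induction_on with
  | H y =>
    rw [Localization.mk_mul, ← Localization.mk_one, Localization.mk_eq_mk_iff,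
      Localization.r_iff_exists] at hy
    obtain ⟨c, hc⟩ := hy
    intro ha
    have h1 : (c : M) * ((1 : p.compl) * (a * y.1)) ∈ p.carrier := by
      have := p.mul_mem a ha (c * y.1)
      convert this using 1
      simp only [OneMemClass.coe_one, one_mul]
      exact mul_left_comm _ _ _
    rw [hc] at h1
    simp only [mul_one] at h1
    exact (c * (s * y.2)).2 h1

theorem PrimeIdeal.isUnit_mk {M : Type u} [CommMonoidWithZero M] (p : PrimeIdeal M) {a : M}
    (s : p.compl) (h : a ∈ p.compl) : IsUnit (Localization.mk a s : p.Loc) := by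
  refine IsUnit.of_mul_eq_one (Localization.mk (s : M) ⟨a, h⟩) ?_
  rw [Localization.mk_mul, ← Localization.mk_one, Localization.mk_eq_mk_iff,
    Localization.r_iff_exists]
  exact ⟨1, by simp [mul_comm]⟩

theorem PrimeIdeal.isUnit_of_locMap {M N : Type u} [CommMonoidWithZero M] [CommMonoidWithZero N]
    (f : M →*₀ N) (p : PrimeIdeal N) (x : (PrimeIdeal.comap f p).Loc)
    (h : IsUnit (PrimeIdeal.locMap f p x)) : IsUnit x := by
  induction x using Localization.induction_on with
  | H y =>
    rw [PrimeIdeal.locMap_mk] at h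
    exact PrimeIdeal.isUnit_mk _ _ (PrimeIdeal.notMem_of_isUnit p _ _ h)

theorem isUnit_germ_spec_iff (M : M0.{u}) (p : (specObj M).carrier)
    {U : Opens (specObj M).carrier} (hp : p ∈ U) (s : (specObj M).sec U) :
    IsUnit ((specObj M).germ p hp s) ↔ IsUnit (SpecSec.val s ⟨p, hp⟩ : PrimeIdeal.Loc p) := by
  rw [MonoidalSpace.isUnit_germ_iff]
  constructor
  · rintro ⟨W, hW, hpW, t, h⟩
    refine IsUnit.of_mul_eq_one (SpecSec.val t ⟨p, hpW⟩) ?_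
    exact (congrFun (congrArg SpecSec.val h) ⟨p, hpW⟩).trans Localization.mk_one
  · intro h
    obtain ⟨V, hpV, hVU, a, f, e⟩ := SpecSec.isLocFrac s ⟨p, hp⟩
    obtain ⟨hf, e'⟩ := e p hpV
    rw [e'] at h
    have ha := PrimeIdeal.notMem_of_isUnit p a _ h
    let I : MIdeal M := ⟨{x | ∃ m, x = a * m}, ⟨0, (mul_zero a).symm⟩, by
      rintro _ ⟨m, rfl⟩ k
      exact ⟨m * k, mul_assoc _ _ _⟩⟩
    let D : Opens (PrimeIdeal M) := ⟨(PrimeIdeal.V I)ᶜ, (PrimeIdeal.isClosed_V I).isOpen_compl⟩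
    have hD : ∀ q, q ∈ D → a ∈ q.compl := fun q hq haq => hq (by
      rintro _ ⟨m, rfl⟩
      exact q.mul_mem a haq m)
    have hpD : p ∈ D := fun hpI => ha (hpI ⟨1, (mul_one a).symm⟩)
    refine ⟨V ⊓ D, inf_le_left.trans hVU, ⟨hpV, hpD⟩,
      (⟨fun q => Localization.mk f ⟨a, hD q.1 q.2.2⟩, fun q => ⟨V ⊓ D, q.2, le_rfl, f, a,
        fun r hr => ⟨hD r hr.2, rfl⟩⟩⟩ : SpecSec M (V ⊓ D)), ?_⟩
    refine SpecSec.ext' fun q => ?_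
    obtain ⟨hfq, eq⟩ := e q.1 q.2.1
    refine Eq.trans (congrArg (· * _) eq) ?_
    refine Eq.trans ?_ (Localization.mk_one (S := q.1.compl)).symm
    refine (Localization.mk_mul a f (⟨f, hfq⟩ : q.1.compl) ⟨a, hD q.1 q.2.2⟩).trans ?_
    rw [← Localization.mk_one, Localization.mk_eq_mk_iff, Localization.r_iff_exists]
    exact ⟨1, by simp [mul_comm]⟩

/-- The morphism `spec N → spec M` induced by `M → N`. -/
def specMap {M N : Type u} [CommMonoidWithZero M] [CommMonoidWithZero N] (f : M →*₀ N) :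
    MonoidalSpace.Hom (specObj (M0.of N)) (specObj (M0.of M)) where
  base := PrimeIdeal.comap f
  cont := PrimeIdeal.continuous_comap f
  app := SpecSec.pull f
  naturality _ _ := rfl
  isLocal p V hp s h := by
    have h' := (isUnit_germ_spec_iff (M0.of N) p (U := MonoidalSpace.pre (PrimeIdeal.continuous_comap f) V)
      hp (SpecSec.pull f V s)).1 h
    refine (isUnit_germ_spec_iff (M0.of M) (PrimeIdeal.comap f p) hp s).2 ?_
    change IsUnit (PrimeIdeal.locMap f p (SpecSec.val s ⟨PrimeIdeal.comap f p, hp⟩)) at h'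
    exact PrimeIdeal.isUnit_of_locMap f p _ h'

/-- The functor `M ↦ spec M`. -/
def spec : M0.{u}ᵒᵖ ⥤ MonoidalSpace.{u} where
  obj M := specObj M.unop
  map {M N} f := specMap (show (N.unop : Type u) →*₀ (M.unop : Type u) from f.unop)
  map_id M := by
    refine MonoidalSpace.Hom.ext' (fun _ => rfl) fun V s => SpecSec.ext' fun p => ?_
    exact PrimeIdeal.locMap_id p.1 _
  map_comp {L M N} f g := by
    refine MonoidalSpace.Hom.ext' (fun _ => rfl) fun V s => SpecSec.ext' fun p => ?_
    exact PrimeIdeal.locMap_comp (show (N.unop : Type u) →*₀ (M.unop : Type u) from g.unop)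
      (show (M.unop : Type u) →*₀ (L.unop : Type u) from f.unop) p.1 _

/-- A monoid scheme: a monoidal space that is locally isomorphic to spectra of monoids. -/
def IsMonoidScheme (X : MonoidalSpace.{u}) : Prop :=
  ∀ x : X.carrier, ∃ U : Opens X.carrier, x ∈ U ∧ ∃ M : M0.{u},
    Nonempty (X.restrict U ≅ spec.obj (op M))

/-- A monoidal space is torsion free if all the groups `𝒪_{X,x}^×` are torsion free. -/
def MonoidalSpace.IsTorsionFree (X : MonoidalSpace.{u}) : Prop :=
  ∀ x : X.carrier, ∀ g : (X.Stalk x)ˣ, IsOfFinOrder g → g = 1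

/-! ### `𝔐₀`-schemes, `ℤ`-schemes and `𝔽₁`-schemes -/

/-- A subfunctor `G` of an `𝔐₀`-functor `F` is open if for every natural transformation
`φ : Hom(M, ·) → F` there is an ideal `𝔞` of `M` with
`φ_N(ρ) ∈ G(N) ↔ ρ(𝔞) N = N` for all `ρ : M → N`. -/
def IsOpenSubfunctor {F : M0.{u} ⥤ Type u} (G : Subfunctor F) : Prop :=
  ∀ (M : M0.{u}) (φ : coyoneda.obj (op M) ⟶ F), ∃ a : MIdeal M,
    ∀ (N : M0.{u}) (ρ : M →*₀ N),
      φ.app N (show M ⟶ N from ρ) ∈ G.obj N ↔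
        {n : N | ∃ m ∈ a.carrier, ∃ k : N, n = ρ m * k} = Set.univ

/-- A family of open subfunctors of `F` covers `F` if `F(𝔽₁[G])` is the union of their values at
`𝔽₁[G]` for every abelian group `G`. -/
def IsOpenCover {F : M0.{u} ⥤ Type u} (𝒰 : Set (Subfunctor F)) : Prop :=
  (∀ G ∈ 𝒰, IsOpenSubfunctor G) ∧
    ∀ (A : Type u) [CommGroup A] (ξ : F.obj (F1of A)), ∃ G ∈ 𝒰, ξ ∈ G.obj (F1of A)

/-- An `𝔐₀`-scheme: an `𝔐₀`-functor with an open cover by representable functors. -/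
def IsM0Scheme (F : M0.{u} ⥤ Type u) : Prop :=
  ∃ 𝒰 : Set (Subfunctor F), IsOpenCover 𝒰 ∧ ∀ G ∈ 𝒰, G.toFunctor.IsCorepresentable

/-- `X` is the geometric realisation of `F`, that is, it is a monoid scheme and
`F ≅ Hom(spec ·, X)`. -/
def IsM0Realisation (F : M0.{u} ⥤ Type u) (X : MonoidalSpace.{u}) : Prop :=
  IsMonoidScheme X ∧ Nonempty (F ≅ spec.rightOp ⋙ yoneda.obj X)

/-- An `𝔐₀`-scheme is Noetherian if it is the union of finitely many (at least one) open
subfunctors `Hom(M_i, ·)` with finitely generated monoids `M_i`. -/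
def IsNoetherianM0 (F : M0.{u} ⥤ Type u) : Prop :=
  ∃ (d : ℕ) (G : Fin (d + 1) → Subfunctor F) (M : Fin (d + 1) → M0.{u}),
    (∀ i, IsOpenSubfunctor (G i) ∧ Monoid.FG (M i) ∧
      Nonempty (coyoneda.obj (op (M i)) ≅ (G i).toFunctor)) ∧
    ∀ (N : M0.{u}) (ξ : F.obj N), ∃ i, ξ ∈ (G i).obj N

/-- A scheme `X` is the geometric realisation of the `ℤ`-functor `F` if `F ≅ Hom(Spec ·, X)`. -/
def IsZRealisation (F : CommRingCat.{u} ⥤ Type u) (X : AlgebraicGeometry.Scheme.{u}) : Prop :=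
  Nonempty (F ≅ AlgebraicGeometry.Scheme.Spec.rightOp ⋙ yoneda.obj X)

/-- Objects of the category `𝔐ℜ = 𝔐₀ ∪ ℭℜ𝔦𝔫𝔤`. -/
inductive MR : Type (u + 1)
  | mon (M : M0.{u})
  | ring (R : CommRingCat.{u})

namespace MR

/-- Morphisms of `𝔐ℜ`; those from a monoid `M` to a ring `R` are the morphisms `M → β*(R)`, and
there are none from a ring to a monoid. -/
def Hom : MR.{u} → MR.{u} → Type u
  | mon M, mon N => M ⟶ N
  | mon M, ring R => M ⟶ betaStar.obj R
  | ring _, mon _ => PEmpty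
  | ring R, ring S => R ⟶ S

/-- Identities of `𝔐ℜ`. -/
def idHom : ∀ A : MR.{u}, Hom A A
  | mon M => 𝟙 M
  | ring R => 𝟙 R

/-- Composition in `𝔐ℜ`. -/
def compHom : ∀ {A B C : MR.{u}}, Hom A B → Hom B C → Hom A C
  | mon M, mon N, mon L, f, g => (show M ⟶ N from f) ≫ (show N ⟶ L from g)
  | mon M, mon N, ring R, f, g => (show M ⟶ N from f) ≫ (show N ⟶ betaStar.obj R from g)
  | mon M, ring R, ring S, f, g =>
    (show M ⟶ betaStar.obj R from f) ≫ betaStar.map (show R ⟶ S from g)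
  | ring R, ring S, ring T, f, g => (show R ⟶ S from f) ≫ (show S ⟶ T from g)
  | ring _, mon _, _, f, _ => f.elim
  | mon _, ring _, mon _, _, g => g.elim
  | ring _, ring _, mon _, _, g => g.elim

instance : LargeCategory.{u} MR.{u} where
  Hom := Hom
  id := idHom
  comp := compHom
  id_comp {A B} f := by
    cases A <;> cases B <;> first | exact Category.id_comp _ | exact PEmpty.elim f
  comp_id {A B} f := by
    cases A <;> cases B <;> first | exact Category.comp_id _ | exact PEmpty.elim f
  assoc {A B C D} f g h := by
    cases A <;> cases B <;> cases C <;> cases D <;>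
      first
      | exact PEmpty.elim f
      | exact PEmpty.elim g
      | exact PEmpty.elim h
      | exact Category.assoc _ _ _

/-- The inclusion `𝔐₀ → 𝔐ℜ`. -/
def inM0 : M0.{u} ⥤ MR.{u} where
  obj := mon
  map f := f
  map_id _ := rfl
  map_comp _ _ := rfl

/-- The inclusion `ℭℜ𝔦𝔫𝔤 → 𝔐ℜ`. -/
def inRing : CommRingCat.{u} ⥤ MR.{u} where
  obj := ring
  map f := f
  map_id _ := rfl
  map_comp _ _ := rfl

/-- The morphism `β*(R) → R` of `𝔐ℜ` given by the identity of `β*(R)`. -/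
def counit (R : CommRingCat.{u}) : inM0.obj (betaStar.obj R) ⟶ inRing.obj R :=
  𝟙 (betaStar.obj R)

end MR

/-- An `𝔽₁`-scheme: a functor `𝒳 : 𝔐ℜ → 𝔖𝔢𝔱` whose restrictions to `𝔐₀` and `ℭℜ𝔦𝔫𝔤` are an
`𝔐₀`-scheme and a `ℤ`-scheme, such that the evaluation `e_K : 𝒳(β*(K)) → 𝒳(K)` is bijective for
every field `K`. -/
structure IsF1Scheme (𝒳 : MR.{u} ⥤ Type u) : Prop where
  m0 : IsM0Scheme (MR.inM0 ⋙ 𝒳)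
  z : ∃ X : AlgebraicGeometry.Scheme.{u}, IsZRealisation (MR.inRing ⋙ 𝒳) X
  eval : ∀ (K : Type u) [Field K], Function.Bijective (𝒳.map (MR.counit (CommRingCat.of K)))

/-- An `𝔽₁`-scheme is Noetherian if both of its restrictions are. -/
structure IsNoetherian (𝒳 : MR.{u} ⥤ Type u) : Prop where
  m0 : IsNoetherianM0 (MR.inM0 ⋙ 𝒳)
  z : ∃ X : AlgebraicGeometry.Scheme.{u}, IsZRealisation (MR.inRing ⋙ 𝒳) X ∧
    AlgebraicGeometry.IsNoetherian X

/-- An `𝔽₁`-scheme is torsion free if the geometric realisation (which is unique up to isomorphism)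
of its restriction to `𝔐₀` is. -/
def IsTorsionFree (𝒳 : MR.{u} ⥤ Type u) : Prop :=
  ∃ X : MonoidalSpace.{u}, IsM0Realisation (MR.inM0 ⋙ 𝒳) X ∧ X.IsTorsionFree

/-! ### Counting function, absolute zeta function, linear Möbius transform -/

/-- `N ∈ ℤ[t]` is the counting function of `𝒳`: `#𝒳(𝔽₁[C]) = N(n + 1)` for every cyclic group `C`
of finite order `n`, and `#𝒳(𝔽_q) = N(q)` for every finite field `𝔽_q` with `q` elements. -/
structure IsCountingFunction (𝒳 : MR.{u} ⥤ Type u) (N : ℤ[X]) : Prop where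
  m0 : ∀ (C : Type u) [CommGroup C] [IsCyclic C] [Finite C],
    Finite (𝒳.obj (.mon (F1of C))) ∧
      (Nat.card (𝒳.obj (.mon (F1of C))) : ℤ) = N.eval ((Nat.card C : ℤ) + 1)
  z : ∀ (K : Type u) [Field K] [Finite K],
    Finite (𝒳.obj (.ring (CommRingCat.of K))) ∧
      (Nat.card (𝒳.obj (.ring (CommRingCat.of K))) : ℤ) = N.eval (Nat.card K : ℤ)

/-- The `m`-th term `N(p^m) / m · p^(-s m)`, `m ≥ 1`, of the logarithm of the congruent zeta
function. -/
def zetaTerm (N : ℤ[X]) (p s : ℝ) (m : ℕ+) : ℝ :=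
  (N.map (Int.castRingHom ℝ)).eval (p ^ (m : ℕ)) / (m : ℕ) * p ^ (-s * (m : ℕ))

/-- `ζ` is the absolute zeta function belonging to the counting function `N`: for real `s > deg N`
the series `∑ N(p^m)/m · p^(-sm)` converges for all `p > 1` and
`ζ(s) = lim_{p → 1} (p - 1)^{N(1)} exp (∑ N(p^m)/m · p^(-sm))`, and `ζ` is meromorphic on `ℂ`
(with the value `0` at its poles). -/
structure IsAbsoluteZeta (N : ℤ[X]) (ζ : ℂ → ℂ) : Prop where
  meromorphic : MeromorphicNFOn ζ Set.univ
  summable : ∀ s : ℝ, (N.natDegree : ℝ) < s → ∀ p : ℝ, 1 < p → Summable (zetaTerm N p s)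
  limit : ∀ s : ℝ, (N.natDegree : ℝ) < s →
    Tendsto (fun p : ℝ => (((p - 1) ^ (N.eval 1) * Real.exp (∑' m, zetaTerm N p s m) : ℝ) : ℂ))
      (𝓝[>] 1) (𝓝 (ζ s))

/-- `κ_a(n) = (1/n) ∑_{m ∣ n} μ(n/m) a^m`. -/
def kappa (a : ℤ) (n : ℕ) : ℚ :=
  (1 / (n : ℚ)) * ∑ m ∈ n.divisors, (ArithmeticFunction.moebius (n / m) : ℚ) * (a : ℚ) ^ m

/-- The linear Möbius transform `M_n : ℤ[t] → ⨁_{a ∈ ℤ} ℤ κ_a(n)`, `t^a ↦ κ_a(n)`. -/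
def linearMobius (n : ℕ) : ℤ[X] →ₗ[ℤ] ⨁ a : ℤ, Submodule.span ℤ {kappa a n} :=
  Polynomial.lsum fun a : ℕ => LinearMap.toSpanSingleton ℤ _
    (DirectSum.lof ℤ ℤ (fun a : ℤ => Submodule.span ℤ {kappa a n}) a
      ⟨kappa a n, Submodule.mem_span_singleton_self _⟩)

/-- The number denoted by an element of `⨁_{a ∈ ℤ} ℤ κ_a(n)`: the sum of its components. -/
def mobiusValue (n : ℕ) : (⨁ a : ℤ, Submodule.span ℤ {kappa a n}) →ₗ[ℤ] ℚ :=
  DirectSum.coeLinearMap fun a : ℤ => Submodule.span ℤ {kappa a n}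

end FOne

end

noncomputable section

namespace FOne

/-! ### Homomorphisms to groups with zero -/

/-! Counting. Collapsing `C` to the trivial group maps the `𝔽₁[C]`-points of an `𝔐₀`-scheme `F` to
its `𝔽₁`-points, and the points are counted fibre by fibre. An `𝔽₁`-point `x` lies in a chart
`Hom(M, ·)`. For values in groups with zero, lying in an open subfunctor depends only on which
elements vanish (`map_F1map_mem_iff`), so the whole fibre over `x` lies in the same chart. It
consists of the maps `M → 𝔽₁[C]` with the same zeros as `x`, that is, of the homomorphisms `Γ → C`,
where `Γ` is the Grothendieck group of the submonoid on which `x` does not vanish (`card_fibre`,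
`suppEquiv`).

The group `Γ` is finitely generated because `M` is. It is torsion free because its tautological
`𝔽₁[Γ]`-point factors through the unit group of a stalk of the realisation
(`specMap_pointUnits_comp`), which makes `Γ` a retract of a torsion free group
(`torsion_eq_one_of_factorisation`). Hence the fibre has `#C ^ r(x)` elements and `N = ∑ₓ (t - 1) ^
r(x)`. A field is reached through `β*(K) ≅ 𝔽₁[Kˣ]` and the bijectivity of the evaluation.

Zeta function. For `N = ∑ c_a t^a` the series equals `-∑ c_a log (1 - p^(a-s))`. Since `N(1) = ∑
c_a`, the factor `(p - 1)^N(1)` turns each `1 - p^(a-s)` into a difference quotient with limit `s -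
a`, so that `ζ(s) = ∏ (s - a)^(-c_a)`. The identity theorem gives uniqueness.

Product. Möbius inversion gives `∑_{d ∣ n} d κ_a(d) = a^n`, which is the cyclotomic identity `1 - a
x = ∏ (1 - x^n)^κ_a(n)` after taking logarithms (`hasSum_kappaInt_mul_log`). Put `x = 1/s` and
combine over `a`. The exponents are integers by the Gauss congruence (`dvd_mobiusPow`). -/

/-- The morphism `𝔽₁[A] → 𝔽₁[B]` induced by a homomorphism of groups. -/
def F1map {A B : Type u} [CommGroup A] [CommGroup B] (a : A →* B) : F1of A ⟶ F1of B :=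
  WithZero.map' a

theorem F1map_apply_eq_zero {A B : Type u} [CommGroup A] [CommGroup B] (a : A →* B)
    (m : WithZero A) : (show WithZero A →*₀ WithZero B from F1map a) m = 0 ↔ m = 0 := by
  induction m using WithZero.recZeroCoe with
  | zero => exact iff_of_true (map_zero _) rfl
  | coe x =>
    exact iff_of_false (by
      intro h
      exact WithZero.coe_ne_zero ((WithZero.map'_coe a x).symm.trans h)) WithZero.coe_ne_zero

/-- Nonzero elements of a group with zero are units, so one nonvanishing image already generates
everything. This reduces the openness condition to a statement about zeros. -/
theorem ideal_span_eq_univ_iff {M : Type u} [CommMonoidWithZero M] {B : Type u} [CommGroup B]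
    (a : MIdeal M) (ρ : M →*₀ WithZero B) :
    {n : WithZero B | ∃ m ∈ a.carrier, ∃ k : WithZero B, n = ρ m * k} = Set.univ ↔
      ∃ m ∈ a.carrier, ρ m ≠ 0 := by
  constructor
  · intro h
    obtain ⟨m, hm, k, e⟩ := (h ▸ Set.mem_univ (1 : WithZero B) :)
    refine ⟨m, hm, fun h0 => ?_⟩
    rw [h0, zero_mul] at e
    exact one_ne_zero e
  · rintro ⟨m, hm, h⟩
    exact Set.eq_univ_of_forall fun n => ⟨m, hm, (ρ m)⁻¹ * n, by rw [mul_inv_cancel_left₀ h]⟩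

/-- The set `{m | x m ≠ 0}`, a submonoid. -/
def supp {M : Type u} [CommMonoidWithZero M] {B : Type u} [CommGroup B] (x : M →*₀ WithZero B) :
    Submonoid M where
  carrier := {m | x m ≠ 0}
  one_mem' := by simp
  mul_mem' ha hb := by
    simp only [Set.mem_ofPred_eq, map_mul] at ha hb ⊢
    exact mul_ne_zero ha hb

/-! ### Homomorphisms with prescribed zeros and the Grothendieck group -/

section supp

variable {M : Type u} [CommMonoidWithZero M] {A B C : Type u} [CommGroup A] [CommGroup B]
  [CommGroup C]

theorem mem_supp {x : M →*₀ WithZero B} {m : M} : m ∈ supp x ↔ x m ≠ 0 := Iff.rfl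

/-- If a product does not vanish under `x`, neither does any factor, so the generators of `M` lying
in `supp x` generate it. -/
theorem supp_fg [hM : Monoid.FG M] (x : M →*₀ WithZero B) : Monoid.FG (supp x) := by
  rw [Monoid.fg_iff_submonoid_fg]
  obtain ⟨T, hT⟩ := hM.fg_top
  classical
  refine ⟨T.filter (· ∈ supp x), le_antisymm ?_ ?_⟩
  · rw [Submonoid.closure_le]
    intro m hm
    exact (Finset.mem_filter.1 hm).2
  · intro m hm
    have hmT : m ∈ Submonoid.closure (T : Set M) := hT ▸ Submonoid.mem_top m
    induction hmT using Submonoid.closure_induction with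
    | mem y hy => exact Submonoid.subset_closure (Finset.mem_filter.2 ⟨hy, hm⟩)
    | one => exact Submonoid.one_mem _
    | mul y z _ _ ihy ihz =>
      rw [mem_supp, map_mul] at hm
      exact Submonoid.mul_mem _ (ihy (left_ne_zero_of_mul hm)) (ihz (right_ne_zero_of_mul hm))

open Classical in
/-- The extension by zero of a homomorphism on `{m | x m ≠ 0}`. -/
def extendZero (x : M →*₀ WithZero B) (f : supp x →* C) : M →*₀ WithZero C where
  toFun m := if h : m ∈ supp x then (f ⟨m, h⟩ : WithZero C) else 0
  map_zero' := dif_neg (by simp [mem_supp])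
  map_one' := by
    rw [dif_pos (supp x).one_mem, ← WithZero.coe_one, WithZero.coe_inj]
    exact map_one f
  map_mul' m m' := by
    by_cases h : m ∈ supp x
    · by_cases h' : m' ∈ supp x
      · rw [dif_pos h, dif_pos h', dif_pos ((supp x).mul_mem h h'), ← WithZero.coe_mul, ← map_mul]
        rfl
      · rw [dif_neg h', dif_neg, mul_zero]
        rw [mem_supp, not_not] at h' ⊢
        rw [map_mul, h', mul_zero]
    · rw [dif_neg h, dif_neg, zero_mul]
      rw [mem_supp, not_not] at h ⊢
      rw [map_mul, h, zero_mul]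

theorem extendZero_coe (x : M →*₀ WithZero B) (f : supp x →* C) (m : supp x) :
    extendZero x f m = f m := dif_pos m.2

theorem extendZero_eq_zero_iff (x : M →*₀ WithZero B) (f : supp x →* C) (m : M) :
    extendZero x f m = 0 ↔ x m = 0 := by
  by_cases h : m ∈ supp x
  · exact iff_of_false (by rw [extendZero_coe x f ⟨m, h⟩]; exact WithZero.coe_ne_zero) h
  · exact iff_of_true (dif_neg h) (not_not.1 h)

/-- The restriction to `{m | x m ≠ 0}` of a homomorphism that does not vanish there. -/
def unzeroHom (x : M →*₀ WithZero B) (ρ : M →*₀ WithZero C) (h : ∀ m, ρ m = 0 → x m = 0) :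
    supp x →* C where
  toFun m := WithZero.unzero fun h0 => m.2 (h m h0)
  map_one' := by
    rw [← WithZero.coe_inj, WithZero.coe_unzero]
    exact map_one ρ
  map_mul' m m' := by
    rw [← WithZero.coe_inj, WithZero.coe_mul]
    simp only [WithZero.coe_unzero]
    exact map_mul ρ _ _

theorem coe_unzeroHom (x : M →*₀ WithZero B) (ρ : M →*₀ WithZero C) (h : ∀ m, ρ m = 0 → x m = 0)
    (m : supp x) : (unzeroHom x ρ h m : WithZero C) = ρ m := WithZero.coe_unzero _

/-- The homomorphisms with the same zeros as `x` are the homomorphisms on the Grothendieck group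
of `{m | x m ≠ 0}`. -/
def suppEquiv (x : M →*₀ WithZero B) (C : Type u) [CommGroup C] :
    {ρ : M →*₀ WithZero C // ∀ m, ρ m = 0 ↔ x m = 0} ≃
      (Algebra.GrothendieckGroup (supp x) →* C) :=
  Equiv.trans
    { toFun := fun ρ => unzeroHom x ρ.1 fun m => (ρ.2 m).1
      invFun := fun f => ⟨extendZero x f, extendZero_eq_zero_iff x f⟩
      left_inv := fun ρ => by
        refine Subtype.ext (MonoidWithZeroHom.ext fun m => ?_)
        by_cases h : m ∈ supp x
        · exact (extendZero_coe x _ ⟨m, h⟩).trans (coe_unzeroHom x ρ.1 _ ⟨m, h⟩)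
        · rw [mem_supp, not_not] at h
          exact ((extendZero_eq_zero_iff x _ m).2 h).trans ((ρ.2 m).2 h).symm
      right_inv := fun f => by
        ext m
        rw [← WithZero.coe_inj, coe_unzeroHom, extendZero_coe] }
    Algebra.GrothendieckGroup.lift

/-- If the tautological morphism to `𝔽₁[Γ]`, `Γ` the Grothendieck group of `{m | x m ≠ 0}`,
factors through a torsion free group, then `Γ` is torsion free. -/
theorem torsion_eq_one_of_factorisation (x : M →*₀ WithZero B)
    (a : A →* Algebra.GrothendieckGroup (supp x)) (η : M →*₀ WithZero A)
    (h : (WithZero.map' a).comp η = extendZero x Algebra.GrothendieckGroup.of)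
    (hA : ∀ g : A, IsOfFinOrder g → g = 1) (γ : Algebra.GrothendieckGroup (supp x))
    (hγ : IsOfFinOrder γ) : γ = 1 := by
  have hη : ∀ m, η m = 0 → x m = 0 := fun m hm => by
    rw [← extendZero_eq_zero_iff x (Algebra.GrothendieckGroup.of (M := supp x)), ← h,
      MonoidWithZeroHom.comp_apply, hm, map_zero]
  -- `η` induces a section `b` of `a`. A torsion element maps under `b` to a torsion element of `A`,
  -- hence to `1`, and `a` recovers it.
  let b := Algebra.GrothendieckGroup.lift (unzeroHom x η hη)
  have hb : (a.comp b) = MonoidHom.id _ := by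
    apply Algebra.GrothendieckGroup.lift.symm.injective
    ext m
    rw [← WithZero.coe_inj]
    have h1 : b (Algebra.GrothendieckGroup.of m) = unzeroHom x η hη m :=
      DFunLike.congr_fun (Algebra.GrothendieckGroup.lift.symm_apply_apply (unzeroHom x η hη)) m
    change WithZero.coe (a (b (Algebra.GrothendieckGroup.of m))) =
      WithZero.coe (Algebra.GrothendieckGroup.of m : Algebra.GrothendieckGroup (supp x))
    rw [h1, ← WithZero.map'_coe, coe_unzeroHom,
      ← extendZero_coe x (Algebra.GrothendieckGroup.of (M := supp x)) m, ← h]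
    rfl
  have := hA (b γ) (b.isOfFinOrder hγ)
  rw [← MonoidHom.id_apply _ γ, ← hb, MonoidHom.comp_apply, this, map_one]

end supp

/-! ### Finiteness and cardinality of sets of homomorphisms -/

theorem finite_monoidHom (M N : Type*) [Monoid M] [Monoid N] [hM : Monoid.FG M] [Finite N] :
    Finite (M →* N) := by
  obtain ⟨T, hT⟩ := hM.fg_top
  refine Finite.of_injective (fun f : M →* N => fun t : T => f t) fun f g h => ?_
  exact MonoidHom.eq_of_eqOn_denseM hT fun t ht => congrFun h ⟨t, ht⟩

theorem finite_monoidWithZeroHom (M N : Type*) [CommMonoidWithZero M] [CommMonoidWithZero N]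
    [Monoid.FG M] [Finite N] : Finite (M →*₀ N) :=
  have := finite_monoidHom M N
  Finite.of_injective (fun f : M →*₀ N => (f : M →* N)) MonoidWithZeroHom.toMonoidHom_injective

/-- A finitely generated torsion free abelian group `Γ` has a rank `r` with
`#Hom(Γ, C) = #C ^ r`. -/
theorem exists_card_monoidHom (Γ : Type*) [CommGroup Γ] [hΓ : Monoid.FG Γ]
    (h : ∀ g : Γ, IsOfFinOrder g → g = 1) :
    ∃ r : ℕ, ∀ (C : Type u) [CommGroup C] [Finite C], Nat.card (Γ →* C) = Nat.card C ^ r := by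
  have : IsMulTorsionFree Γ := IsMulTorsionFree.of_not_isOfFinOrder fun g hg hfin => hg (h g hfin)
  have : Group.FG Γ := Group.fg_iff_monoid_fg.2 hΓ
  have : Module.Finite ℤ (Additive Γ) := inferInstance
  have : Module.Free ℤ (Additive Γ) := inferInstance
  let b := Module.Free.chooseBasis ℤ (Additive Γ)
  refine ⟨Nat.card (Module.Free.ChooseBasisIndex ℤ (Additive Γ)), fun C _ _ => ?_⟩
  have e : (Γ →* C) ≃ (Module.Free.ChooseBasisIndex ℤ (Additive Γ) → Additive C) :=
    (MonoidHom.toAdditive.trans (addMonoidHomLequivInt ℤ).toEquiv).trans (b.constr ℤ).symm.toEquiv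
  rw [Nat.card_congr e, Nat.card_fun]
  rfl

/-! ### Open representable subfunctors -/

section functor

variable {F : M0.{u} ⥤ Type u}

/-- One ideal of `𝔽₁[A]` tests both memberships, applied to `F1map a` and to the identity. Both
morphisms kill only `0`, so the two tests agree. -/
theorem map_F1map_mem_iff {G : Subfunctor F} (hG : IsOpenSubfunctor G) {A B : Type u}
    [CommGroup A] [CommGroup B] (a : A →* B) (ξ : F.obj (F1of A)) :
    F.map (F1map a) ξ ∈ G.obj (F1of B) ↔ ξ ∈ G.obj (F1of A) := by
  obtain ⟨I, hI⟩ := hG (F1of A) (coyonedaEquiv.symm ξ)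
  have h1 := (hI (F1of B) (F1map a)).trans (ideal_span_eq_univ_iff I (F1map a))
  have h2 := (hI (F1of A) (𝟙 (F1of A))).trans
    (ideal_span_eq_univ_iff I (MonoidWithZeroHom.id (WithZero A)))
  have e1 : (coyonedaEquiv.symm ξ).app (F1of B) (F1map a) = F.map (F1map a) ξ := rfl
  have e2 : (coyonedaEquiv.symm ξ).app (F1of A) (𝟙 (F1of A)) = ξ := by
    exact F.map_id_apply (F1of A) ξ
  rw [← e1]
  refine h1.trans (Iff.trans ?_ (h2.symm.trans (by
    change (coyonedaEquiv.symm ξ).app (F1of A) (𝟙 (F1of A)) ∈ _ ↔ _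
    rw [e2])))
  refine exists_congr fun m => and_congr_right fun _ => not_congr ?_
  exact F1map_apply_eq_zero a m

theorem subfunctor_hom_map {G : Subfunctor F} {M : M0.{u}}
    (e : coyoneda.obj (op M) ≅ G.toFunctor) {N L : M0.{u}} (ρ : M ⟶ N) (f : N ⟶ L) :
    (e.hom.app L (ρ ≫ f)).1 = F.map f (e.hom.app N ρ).1 :=
  congrArg Subtype.val (NatTrans.naturality_apply e.hom f ρ)

/-- `𝔽₁` has only the elements `0` and `1`, so a morphism to it is determined by its zeros. -/
theorem eq_F1map_one_comp_iff {M : M0.{u}} {C : Type u} [CommGroup C] (ρ : M ⟶ F1of C)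
    (x : M ⟶ F1of PUnit.{u + 1}) :
    ρ ≫ F1map (1 : C →* PUnit) = x ↔
      ∀ m : M, (show (M : Type u) →*₀ WithZero C from ρ) m = 0 ↔
        (show (M : Type u) →*₀ WithZero PUnit from x) m = 0 := by
  have key : ∀ y z : WithZero PUnit.{u + 1}, (y = 0 ↔ z = 0) → y = z := by
    intro y z h
    induction y using WithZero.recZeroCoe with
    | zero => exact (h.1 rfl).symm
    | coe y =>
      induction z using WithZero.recZeroCoe with
      | zero => exact h.2 rfl
      | coe z => rfl
  constructor
  · rintro rfl m
    exact (F1map_apply_eq_zero _ _).symm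
  · intro h
    refine MonoidWithZeroHom.ext fun m => key _ _ ?_
    exact (F1map_apply_eq_zero _ _).trans (h m)

/-- The fibre of `F(𝔽₁[C]) → F(𝔽₁)` over a point of an open representable subfunctor. -/
theorem card_fibre {G : Subfunctor F} (hG : IsOpenSubfunctor G) {M : M0.{u}}
    (e : coyoneda.obj (op M) ≅ G.toFunctor) (x : M ⟶ F1of PUnit.{u + 1}) (C : Type u)
    [CommGroup C] :
    Nat.card {ξ : F.obj (F1of C) //
      F.map (F1map (1 : C →* PUnit)) ξ = (e.hom.app (F1of PUnit.{u + 1}) x).1} =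
    Nat.card (Algebra.GrothendieckGroup
      (supp (show (M : Type u) →*₀ WithZero PUnit from x)) →* C) := by
  rw [← Nat.card_congr (suppEquiv (show (M : Type u) →*₀ WithZero PUnit from x) C)]
  have hinj : ∀ N, Function.Injective (e.hom.app N) := fun N => (e.app N).toEquiv.injective
  have hmem : ∀ ρ : M ⟶ F1of C,
      F.map (F1map (1 : C →* PUnit)) (e.hom.app (F1of C) ρ).1 =
        (e.hom.app (F1of PUnit.{u + 1}) x).1 ↔
      ∀ m : M, (show (M : Type u) →*₀ WithZero C from ρ) m = 0 ↔
        (show (M : Type u) →*₀ WithZero PUnit from x) m = 0 := fun ρ => by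
    rw [← eq_F1map_one_comp_iff, ← subfunctor_hom_map]
    exact Subtype.ext_iff.symm.trans (hinj _).eq_iff
  refine (Nat.card_congr (Equiv.ofBijective
    (fun ρ : {ρ : (M : Type u) →*₀ WithZero C // ∀ m, ρ m = 0 ↔
        (show (M : Type u) →*₀ WithZero PUnit from x) m = 0} =>
      (⟨(e.hom.app (F1of C) (show M ⟶ F1of C from ρ.1)).1, (hmem ρ.1).2 ρ.2⟩ : {ξ : F.obj (F1of C) //
      F.map (F1map (1 : C →* PUnit)) ξ = (e.hom.app (F1of PUnit.{u + 1}) x).1})) ⟨?_, ?_⟩)).symm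
  · intro ρ σ h
    have h' := congrArg Subtype.val h
    exact Subtype.ext (hinj (F1of C) (Subtype.ext h'))
  · rintro ⟨ξ, hξ⟩
    -- Openness reflects membership along `C → 1`: the image of `ξ` lies in the chart, so `ξ` does
    -- too.
    have hξG : ξ ∈ G.obj (F1of C) := by
      rw [← map_F1map_mem_iff hG (1 : C →* PUnit) ξ, hξ]
      exact (e.hom.app (F1of PUnit.{u + 1}) x).2
    obtain ⟨ρ, hρ⟩ := (e.app (F1of C)).toEquiv.surjective ⟨ξ, hξG⟩
    have hρ' : (e.hom.app (F1of C) ρ).1 = ξ := congrArg Subtype.val hρ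
    exact ⟨⟨ρ, (hmem ρ).1 (by rw [hρ']; exact hξ)⟩, Subtype.ext hρ'⟩

/-- Finitely many charts cover, and a finitely generated monoid has only finitely many morphisms to
a finite one. -/
theorem IsNoetherianM0.finite (hF : IsNoetherianM0 F) (N : M0.{u}) [Finite N] :
    Finite (F.obj N) := by
  obtain ⟨d, G, M, h, hcov⟩ := hF
  have : ∀ i, Finite ((G i).obj N) := fun i => by
    obtain ⟨-, hfg, ⟨e⟩⟩ := h i
    have : Finite ((coyoneda.obj (op (M i))).obj N) :=
      finite_monoidWithZeroHom (M i : Type u) (N : Type u)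
    exact Finite.of_surjective _ (e.app N).toEquiv.surjective
  exact Finite.of_surjective (fun y : Σ i, (G i).obj N => y.2.1) fun ξ => by
    obtain ⟨i, hi⟩ := hcov N ξ
    exact ⟨⟨i, ξ, hi⟩, rfl⟩

/-- A Noetherian `𝔐₀`-scheme whose `𝔽₁[Γ]`-valued points come from `𝔽₁[A]`-valued points with
torsion free `A` has a polynomial counting its `𝔽₁[C]`-valued points. -/
theorem IsNoetherianM0.exists_polynomial (hF : IsNoetherianM0 F)
    (hfac : ∀ (Γ : Type u) [CommGroup Γ] (ξ : F.obj (F1of Γ)), ∃ (A : Type u) (_ : CommGroup A)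
      (a : A →* Γ) (η : F.obj (F1of A)), (∀ g : A, IsOfFinOrder g → g = 1) ∧
        F.map (F1map a) η = ξ) :
    ∃ N : ℤ[X], ∀ (C : Type u) [CommGroup C] [Finite C], Finite (F.obj (F1of C)) ∧
      (Nat.card (F.obj (F1of C)) : ℤ) = N.eval ((Nat.card C : ℤ) + 1) := by
  have hfin : ∀ (C : Type u) [CommGroup C] [Finite C], Finite (F.obj (F1of C)) := fun C _ _ => by
    have : Finite (F1of C) := inferInstanceAs (Finite (Option C))
    exact hF.finite _
  have hr : ∀ x : F.obj (F1of PUnit.{u + 1}), ∃ r : ℕ, ∀ (C : Type u) [CommGroup C] [Finite C],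
      Nat.card {ξ : F.obj (F1of C) // F.map (F1map (1 : C →* PUnit)) ξ = x} = Nat.card C ^ r := by
    obtain ⟨d, G, M, h, hcov⟩ := hF
    intro x
    obtain ⟨i, hi⟩ := hcov _ x
    obtain ⟨hG, hfg, ⟨e⟩⟩ := h i
    obtain ⟨ρ, hρ⟩ := (e.app (F1of PUnit.{u + 1})).toEquiv.surjective ⟨x, hi⟩
    obtain rfl : (e.hom.app _ ρ).1 = x := congrArg Subtype.val hρ
    let x' : (M i : Type u) →*₀ WithZero PUnit.{u + 1} := ρ
    let Γ := Algebra.GrothendieckGroup (supp x')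
    have : Monoid.FG (supp x') := supp_fg x'
    have htor : ∀ g : Γ, IsOfFinOrder g → g = 1 := by
      -- The tautological `𝔽₁[Γ]`-point of the chart. Its lift `η` to `𝔽₁[A]` is a point of `F`
      -- only; openness places it in the same chart, where it becomes a morphism out of `M i`.
      let c : M i ⟶ F1of Γ := extendZero x' Algebra.GrothendieckGroup.of
      obtain ⟨A, _, a, η, hA, hη⟩ := hfac Γ (e.hom.app (F1of Γ) c).1
      have hηG : η ∈ (G i).obj (F1of A) := by
        rw [← map_F1map_mem_iff hG a η, hη]
        exact (e.hom.app (F1of Γ) c).2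
      obtain ⟨η', hη'⟩ := (e.app (F1of A)).toEquiv.surjective ⟨η, hηG⟩
      obtain rfl : (e.hom.app _ η').1 = η := congrArg Subtype.val hη'
      rw [← subfunctor_hom_map] at hη
      exact torsion_eq_one_of_factorisation x' a η'
        ((e.app (F1of Γ)).toEquiv.injective (Subtype.ext hη)) hA
    obtain ⟨r, hr⟩ := exists_card_monoidHom.{u} Γ htor
    exact ⟨r, fun C _ _ => (card_fibre hG e ρ C).trans (hr C)⟩
  choose r hr using hr
  have : Finite (F.obj (F1of PUnit.{u + 1})) := hfin _
  have := Fintype.ofFinite (F.obj (F1of PUnit.{u + 1}))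
  -- At `#C + 1` the summand of `x` takes the value `#C ^ r x`, the size of the fibre over `x`.
  refine ⟨∑ x, (Polynomial.X - 1) ^ r x, fun C _ _ => ⟨hfin C, ?_⟩⟩
  have := hfin C
  rw [← Nat.card_congr (Equiv.sigmaFiberEquiv (F.map (F1map (1 : C →* PUnit.{u + 1})))),
    Nat.card_sigma]
  simp only [Polynomial.eval_finsetSum, Polynomial.eval_pow, Polynomial.eval_sub,
    Polynomial.eval_X, Polynomial.eval_one, add_sub_cancel_right, Nat.cast_sum]
  exact Finset.sum_congr rfl fun x _ => by rw [← Nat.cast_pow, ← hr x C]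

end functor

/-! ### Points of monoidal spaces with values in `𝔽₁[G]` -/

namespace MonoidalSpace

variable (X : MonoidalSpace.{u}) (y : X.carrier)

theorem germ_res {U V : Opens X.carrier} (h : U ≤ V) (hy : y ∈ U) (s : X.sec V) :
    X.germ y hy (X.res h s) = X.germ y (h hy) s :=
  DirectLimit.mk_apply (f := X.resAt y) (OrderDual.toDual (⟨V, h hy⟩ : OpenNhdsOf y))
    (OrderDual.toDual (⟨U, hy⟩ : OpenNhdsOf y))
    (show X.SecAt y (OrderDual.toDual (⟨V, h hy⟩ : OpenNhdsOf y)) from s) h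

theorem germ_mul {U : Opens X.carrier} (hy : y ∈ U) (s t : X.sec U) :
    X.germ y hy (s * t) = X.germ y hy s * X.germ y hy t :=
  (DirectLimit.mul_def (f := X.resAt y) (OrderDual.toDual (⟨U, hy⟩ : OpenNhdsOf y))
    (show X.SecAt y (OrderDual.toDual (⟨U, hy⟩ : OpenNhdsOf y)) from s)
    (show X.SecAt y (OrderDual.toDual (⟨U, hy⟩ : OpenNhdsOf y)) from t)).symm

theorem germ_one {U : Opens X.carrier} (hy : y ∈ U) : X.germ y hy (1 : X.sec U) = 1 :=
  (DirectLimit.one_def (f := X.resAt y) (OrderDual.toDual (⟨U, hy⟩ : OpenNhdsOf y))).symm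

theorem germ_zero {U : Opens X.carrier} (hy : y ∈ U) : X.germ y hy (0 : X.sec U) = 0 :=
  (DirectLimit.zero_def (f := X.resAt y) (OrderDual.toDual (⟨U, hy⟩ : OpenNhdsOf y))).symm

theorem exists_germ_eq (g : X.Stalk y) :
    ∃ (U : Opens X.carrier) (hy : y ∈ U) (s : X.sec U), g = X.germ y hy s := by
  obtain ⟨W, t, rfl⟩ := DirectLimit.exists_eq_mk (X.resAt y) g
  exact ⟨(OrderDual.ofDual W).toOpens, (OrderDual.ofDual W).mem, t, rfl⟩

theorem exists_germ_eq₂ (g h : X.Stalk y) : ∃ (U : Opens X.carrier) (hy : y ∈ U) (s t : X.sec U),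
    g = X.germ y hy s ∧ h = X.germ y hy t := by
  obtain ⟨U, hU, s, rfl⟩ := X.exists_germ_eq y g
  obtain ⟨V, hV, t, rfl⟩ := X.exists_germ_eq y h
  exact ⟨U ⊓ V, ⟨hU, hV⟩, X.res inf_le_left s, X.res inf_le_right t,
    (X.germ_res y inf_le_left ⟨hU, hV⟩ s).symm, (X.germ_res y inf_le_right ⟨hU, hV⟩ t).symm⟩

end MonoidalSpace

/-! ### The tautological point with values in `𝔽₁` of the unit group of a stalk -/

open Classical in
/-- The map `M → 𝔽₁[Mˣ]` that is the identity on units and zero elsewhere. -/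
def toUnits (M : Type u) [CommMonoidWithZero M] [Nontrivial M] : M →*₀ WithZero Mˣ where
  toFun m := if h : IsUnit m then (h.unit : WithZero Mˣ) else 0
  map_zero' := dif_neg not_isUnit_zero
  map_one' := by
    rw [dif_pos isUnit_one, ← WithZero.coe_one, WithZero.coe_inj]
    exact Units.ext rfl
  map_mul' a b := by
    by_cases h : IsUnit (a * b)
    · have h' := IsUnit.mul_iff.1 h
      rw [dif_pos h, dif_pos h'.1, dif_pos h'.2, ← WithZero.coe_mul, WithZero.coe_inj]
      exact Units.ext rfl
    · rw [dif_neg h]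
      by_cases ha : IsUnit a
      · rw [dif_neg fun hb => h (ha.mul hb), mul_zero]
      · rw [dif_neg ha, zero_mul]

theorem toUnits_coe {M : Type u} [CommMonoidWithZero M] [Nontrivial M] (m : Mˣ) :
    toUnits M m = m := by
  refine (dif_pos m.isUnit).trans ?_
  rw [WithZero.coe_inj]
  exact Units.ext rfl

theorem toUnits_of_not_isUnit {M : Type u} [CommMonoidWithZero M] [Nontrivial M] {m : M}
    (h : ¬IsUnit m) : toUnits M m = 0 := dif_neg h

theorem mk_one_mul {M : Type u} [CommMonoidWithZero M] (p : PrimeIdeal M) (a b : M) :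
    (Localization.mk (a * b) 1 : p.Loc) = Localization.mk a 1 * Localization.mk b 1 := by
  rw [Localization.mk_mul, mul_one]

/-- The function on germs at `y` given by the value at `𝔭` of the corresponding section of
`𝔽₁[𝒪_{X,y}ˣ]`. -/
def germVal (X : MonoidalSpace.{u}) (y : X.carrier) [Nontrivial (X.Stalk y)]
    (p : PrimeIdeal (WithZero (X.Stalk y)ˣ)) (g : X.Stalk y) : p.Loc :=
  Localization.mk (toUnits (X.Stalk y) g) 1

section germVal

variable (X : MonoidalSpace.{u}) (y : X.carrier) [Nontrivial (X.Stalk y)]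
  (p : PrimeIdeal (WithZero (X.Stalk y)ˣ))

theorem germVal_zero : germVal X y p 0 = Localization.mk 0 1 := by
  rw [germVal, map_zero]

theorem germVal_one : germVal X y p 1 = Localization.mk 1 1 := by
  rw [germVal, map_one]

theorem germVal_mul (g h : X.Stalk y) :
    germVal X y p (g * h) = germVal X y p g * germVal X y p h := by
  rw [germVal, map_mul]
  exact mk_one_mul p _ _

/-- `toUnits` sends every nonunit to zero, which lies in every prime ideal. This makes
`canonicalPoint` local. -/
theorem isUnit_of_germVal {g : X.Stalk y} (h : IsUnit (germVal X y p g)) : IsUnit g := by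
  have h1 := PrimeIdeal.notMem_of_isUnit p _ _ h
  by_contra hc
  refine h1 ?_
  rw [toUnits_of_not_isUnit hc]
  exact p.zero_mem

/-- The section of `𝔽₁[𝒪_{X,y}ˣ]` given by a section of `𝒪_X`. -/
def germSec {V : Opens X.carrier} (W : Opens (PrimeIdeal (WithZero (X.Stalk y)ˣ)))
    (hW : ∀ p ∈ W, y ∈ V) : X.sec V →*₀ SpecSec (WithZero (X.Stalk y)ˣ) W where
  toFun s := ⟨fun p => germVal X y p.1 (X.germ y (hW p.1 p.2) s),
    fun p => ⟨W, p.2, le_rfl, toUnits (X.Stalk y) (X.germ y (hW p.1 p.2) s), 1,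
      fun q _ => ⟨q.one_notMem, rfl⟩⟩⟩
  map_zero' := SpecSec.ext' fun p =>
    (congrArg (germVal X y p.1) (X.germ_zero y (hW p.1 p.2))).trans (germVal_zero X y p.1)
  map_one' := SpecSec.ext' fun p =>
    (congrArg (germVal X y p.1) (X.germ_one y (hW p.1 p.2))).trans (germVal_one X y p.1)
  map_mul' s t := SpecSec.ext' fun p =>
    (congrArg (germVal X y p.1) (X.germ_mul y (hW p.1 p.2) s t)).trans (germVal_mul X y p.1 _ _)

/-- The tautological morphism `spec 𝔽₁[𝒪_{X,y}ˣ] → X` with image `y`. -/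
def canonicalPoint : MonoidalSpace.Hom (specObj (F1of (X.Stalk y)ˣ)) X where
  base _ := y
  cont := continuous_const
  -- The preimage of `V` under a constant map is empty or everything; any point of it witnesses `y ∈
  -- V`, as needed to take germs at `y`.
  app V := germSec X y (MonoidalSpace.pre continuous_const V) fun _ hp => hp
  naturality {U _} h s := SpecSec.ext' fun p =>
    congrArg (germVal X y p.1) (X.germ_res y h (show y ∈ U from p.2) s)
  isLocal p V hp _ h :=
    isUnit_of_germVal X y p ((isUnit_germ_spec_iff (F1of (X.Stalk y)ˣ) p
      (U := MonoidalSpace.pre continuous_const V) hp _).1 h)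

end germVal

/-! ### Morphisms from the one-point space `spec 𝔽₁[G]` -/

section WithZero

variable {G : Type u} [CommGroup G]

theorem isUnit_of_mem_compl (q : PrimeIdeal (WithZero G)) (a : q.compl) : IsUnit (a : WithZero G) :=
  isUnit_iff_ne_zero.2 fun h => a.2 (h ▸ q.zero_mem)

/-- The only point of `spec 𝔽₁[G]`. -/
def closedPoint (G : Type u) [CommGroup G] : PrimeIdeal (WithZero G) where
  carrier := {0}
  zero_mem := rfl
  mul_mem := by
    rintro _ rfl m
    exact zero_mul m
  ne_univ h := one_ne_zero (h.ge (Set.mem_univ (1 : WithZero G)))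
  prime _ _ ha hb := mul_ne_zero ha hb

/-- A nonzero element of a group with zero is a unit, and a prime ideal contains no unit. -/
theorem eq_closedPoint (q : PrimeIdeal (WithZero G)) : q = closedPoint G := by
  refine PrimeIdeal.ext (Set.Subset.antisymm (fun a ha => ?_) ?_)
  · by_contra h
    have h' : a ≠ 0 := fun h0 => h h0
    exact q.one_notMem (mul_inv_cancel₀ h' ▸ q.mul_mem a ha a⁻¹)
  · intro a ha
    obtain rfl : a = 0 := ha
    exact q.zero_mem

/-- The isomorphism `𝔽₁[G]_𝔮 → 𝔽₁[G]`. -/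
def locEval (q : PrimeIdeal (WithZero G)) : q.Loc →* WithZero G :=
  (Localization.monoidOf q.compl).lift (g := MonoidHom.id _) fun a => isUnit_of_mem_compl q a

theorem locEval_mk (q : PrimeIdeal (WithZero G)) (a : WithZero G) :
    locEval q (Localization.mk a 1) = a := by
  rw [Localization.mk_one_eq_monoidOf_mk]
  exact Submonoid.LocalizationMap.lift_eq _ _ a

theorem mk_locEval (q : PrimeIdeal (WithZero G)) (x : q.Loc) :
    Localization.mk (locEval q x) 1 = x := by
  suffices ∃ a, x = Localization.mk a 1 by
    obtain ⟨a, rfl⟩ := this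
    rw [locEval_mk]
  induction x using Localization.induction_on with
  | H z =>
    have h0 : (z.2 : WithZero G) ≠ 0 := (isUnit_of_mem_compl q z.2).ne_zero
    -- Denominators are already invertible in `𝔽₁[G]`, so localising changes nothing.
    refine ⟨z.1 * (z.2 : WithZero G)⁻¹, ?_⟩
    rw [Localization.mk_eq_mk_iff, Localization.r_iff_exists]
    refine ⟨1, ?_⟩
    simp only [OneMemClass.coe_one, one_mul]
    rw [mul_comm z.1, mul_inv_cancel_left₀ h0]

variable {X : MonoidalSpace.{u}} (f : MonoidalSpace.Hom (specObj (F1of G)) X)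

/-- The value of a section at the point given by a morphism `spec 𝔽₁[G] → X`. -/
def secVal (V : Opens X.carrier) (h : f.base (closedPoint G) ∈ V) : X.sec V →*₀ WithZero G where
  toFun s := locEval (closedPoint G)
    (SpecSec.val (U := MonoidalSpace.pre f.cont V) (f.app V s) ⟨closedPoint G, h⟩)
  map_zero' := by
    rw [map_zero]
    exact locEval_mk (closedPoint G) 0
  map_one' := by
    rw [map_one]
    exact locEval_mk (closedPoint G) 1
  map_mul' s t := by
    rw [map_mul]
    exact map_mul (locEval (closedPoint G)) _ _

theorem secVal_res {U V : Opens X.carrier} (h : U ≤ V) (hU : f.base (closedPoint G) ∈ U)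
    (s : X.sec V) : secVal f U hU (X.res h s) = secVal f V (h hU) s :=
  congrArg (fun t => locEval (closedPoint G)
    (SpecSec.val (U := MonoidalSpace.pre f.cont U) t ⟨closedPoint G, hU⟩)) (f.naturality h s)

/-- The function underlying `pointVal`. -/
def pointFun : X.Stalk (f.base (closedPoint G)) → WithZero G :=
  DirectLimit.lift (X.resAt (f.base (closedPoint G)))
    (fun U s => secVal f (OrderDual.ofDual U).toOpens (OrderDual.ofDual U).mem s)
    fun _ V h s => (secVal_res f h (OrderDual.ofDual V).mem s).symm

theorem pointFun_germ {U : Opens X.carrier} (h : f.base (closedPoint G) ∈ U) (s : X.sec U) :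
    pointFun f (X.germ _ h s) = secVal f U h s := rfl

/-- The homomorphism `𝒪_{X,y} → 𝔽₁[G]` induced by a morphism `spec 𝔽₁[G] → X` with image `y`. -/
def pointVal : X.Stalk (f.base (closedPoint G)) →*₀ WithZero G where
  toFun := pointFun f
  map_zero' := by
    rw [← X.germ_zero _ (U := ⊤) trivial]
    exact (pointFun_germ f (U := ⊤) trivial 0).trans (map_zero _)
  map_one' := by
    rw [← X.germ_one _ (U := ⊤) trivial]
    exact (pointFun_germ f (U := ⊤) trivial 1).trans (map_one _)
  map_mul' g h := by
    obtain ⟨U, hU, s, t, rfl, rfl⟩ := X.exists_germ_eq₂ _ g h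
    rw [← X.germ_mul]
    exact map_mul (secVal f U hU) s t

theorem pointVal_germ {U : Opens X.carrier} (h : f.base (closedPoint G) ∈ U) (s : X.sec U) :
    pointVal f (X.germ _ h s) = locEval (closedPoint G)
      (SpecSec.val (U := MonoidalSpace.pre f.cont U) (f.app U s) ⟨closedPoint G, h⟩) := rfl

/-- This is locality of `f` on stalks, transported through the identification of the local monoid of
`spec 𝔽₁[G]` with `𝔽₁[G]`. It forces nonunits of the stalk to go to zero, so that the point is
determined by its effect on units. -/
theorem isUnit_of_pointVal (g : X.Stalk (f.base (closedPoint G))) (h : IsUnit (pointVal f g)) :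
    IsUnit g := by
  obtain ⟨U, hU, s, rfl⟩ := X.exists_germ_eq _ g
  refine f.isLocal _ U hU s ((isUnit_germ_spec_iff _ _ hU _).2 ?_)
  rw [pointVal_germ] at h
  refine Eq.mp (congrArg IsUnit (mk_locEval (closedPoint G) _)) ?_
  refine PrimeIdeal.isUnit_mk _ _ ?_
  exact h.ne_zero

/-- The stalk maps to `𝔽₁[G]`, where `0 ≠ 1`. Nontriviality is what makes `toUnits` preserve zero.
-/
theorem nontrivial_stalk : Nontrivial (X.Stalk (f.base (closedPoint G))) := by
  refine ⟨0, 1, fun h => ?_⟩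
  have := congrArg (pointVal f) h
  rw [map_zero, map_one] at this
  exact zero_ne_one this

/-- The homomorphism `𝒪_{X,y}ˣ → G` induced by a morphism `spec 𝔽₁[G] → X` with image `y`. -/
def pointUnits : (X.Stalk (f.base (closedPoint G)))ˣ →* G :=
  (WithZero.unitsWithZeroEquiv : (WithZero G)ˣ ≃* G).toMonoidHom.comp (Units.map (pointVal f : _ →* WithZero G))

theorem coe_pointUnits (g : (X.Stalk (f.base (closedPoint G)))ˣ) :
    (pointUnits f g : WithZero G) = pointVal f g := WithZero.coe_unzero _

/-- Every `𝔽₁[G]`-valued point of `X` factors through a tautological one. -/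
theorem specMap_pointUnits_comp [Nontrivial (X.Stalk (f.base (closedPoint G)))] :
    spec.map (F1map (pointUnits f)).op ≫
      (show spec.obj (op (F1of (X.Stalk (f.base (closedPoint G)))ˣ)) ⟶ X from
        canonicalPoint X (f.base (closedPoint G))) = f := by
  refine MonoidalSpace.Hom.ext' (fun p => congrArg f.base (eq_closedPoint p).symm) fun V s => ?_
  refine SpecSec.ext' fun p => ?_
  obtain ⟨p, hp⟩ := p
  obtain rfl := eq_closedPoint p
  refine (PrimeIdeal.locMap_mk _ _ _ _).trans ?_
  refine Eq.trans ?_ (mk_locEval (closedPoint G) _)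
  refine Eq.trans ?_ (congrArg (fun t => Localization.mk t 1) (pointVal_germ f hp s))
  -- On units both sides are the value of `f`; on nonunits the left side is zero by definition and
  -- the right side by locality.
  have key : ∀ g, WithZero.map' (pointUnits f) (toUnits _ g) =
      pointVal f g := by
    intro g
    by_cases h : IsUnit g
    · obtain ⟨g, rfl⟩ := h
      rw [toUnits_coe]
      exact (WithZero.map'_coe _ _).trans (coe_pointUnits f g)
    · rw [toUnits_of_not_isUnit h, map_zero]
      by_contra hc
      exact h (isUnit_of_pointVal f g (isUnit_iff_ne_zero.2 (Ne.symm hc)))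
  rw [← key]
  exact congrArg (Localization.mk _) (Subtype.ext (map_one (WithZero.map' (pointUnits f))))

end WithZero

/-- The `𝔽₁[Γ]`-valued points of a functor with torsion free realisation factor through
`𝔽₁[A]`-valued points with torsion free `A`. -/
theorem IsM0Realisation.exists_factorisation {F : M0.{u} ⥤ Type u} {X : MonoidalSpace.{u}}
    (hX : IsM0Realisation F X) (ht : X.IsTorsionFree) (Γ : Type u) [CommGroup Γ]
    (ξ : F.obj (F1of Γ)) : ∃ (A : Type u) (_ : CommGroup A) (a : A →* Γ) (η : F.obj (F1of A)),
      (∀ g : A, IsOfFinOrder g → g = 1) ∧ F.map (F1map a) η = ξ := by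
  obtain ⟨-, ⟨e⟩⟩ := hX
  let f : MonoidalSpace.Hom (specObj (F1of Γ)) X := e.hom.app (F1of Γ) ξ
  have := nontrivial_stalk f
  obtain ⟨η, hη⟩ := (e.app (F1of (X.Stalk (f.base (closedPoint Γ)))ˣ)).toEquiv.surjective
    (canonicalPoint X (f.base (closedPoint Γ)))
  refine ⟨(X.Stalk (f.base (closedPoint Γ)))ˣ, inferInstance, pointUnits f, η, ht _,
    (e.app (F1of Γ)).toEquiv.injective ?_⟩
  refine (NatTrans.naturality_apply e.hom (F1map (pointUnits f)) η).trans ?_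
  exact (congrArg ((spec.rightOp ⋙ yoneda.obj X).map (F1map (pointUnits f))) hη).trans
    (specMap_pointUnits_comp f)

/-! ### The counting function -/

/-- The isomorphism `𝔽₁[Kˣ] ≅ β*(K)` for a field `K`. -/
def F1ofUnitsIso (K : Type u) [Field K] : F1of Kˣ ≅ betaStar.obj (CommRingCat.of K) := by
  classical
  let e : WithZero Kˣ ≃* K := WithZero.withZeroUnitsEquiv
  let f : WithZero Kˣ →*₀ K := ⟨⟨e, map_zero e⟩, map_one e, map_mul e⟩
  let g : K →*₀ WithZero Kˣ := ⟨⟨e.symm, map_zero e.symm⟩, map_one e.symm, map_mul e.symm⟩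
  exact
  { hom := f
    inv := g
    hom_inv_id := MonoidWithZeroHom.ext e.symm_apply_apply
    inv_hom_id := MonoidWithZeroHom.ext e.apply_symm_apply }

/-- The polynomial counts `𝔽₁[C]`-points for every finite abelian `C`. Taking `C = Kˣ` and using the
evaluation bijection gives the count over `K`, with argument `#Kˣ + 1 = #K`. -/
theorem exists_isCountingFunction (𝒳 : MR.{u} ⥤ Type u) (h𝒳 : IsF1Scheme 𝒳)
    (hN : IsNoetherian 𝒳) (ht : IsTorsionFree 𝒳) : ∃ N : ℤ[X], IsCountingFunction 𝒳 N := by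
  obtain ⟨X, hX, hXt⟩ := ht
  obtain ⟨N, h⟩ := hN.m0.exists_polynomial fun Γ _ ξ => hX.exists_factorisation hXt Γ ξ
  refine ⟨N, fun C _ _ _ => h C, fun K _ _ => ?_⟩
  have e : (MR.inM0 ⋙ 𝒳).obj (F1of Kˣ) ≃ 𝒳.obj (.ring (CommRingCat.of K)) :=
    ((MR.inM0 ⋙ 𝒳).mapIso (F1ofUnitsIso K)).toEquiv.trans (Equiv.ofBijective _ (h𝒳.eval K))
  obtain ⟨hfin, hcard⟩ := h Kˣ
  refine ⟨Finite.of_equiv _ e, ?_⟩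
  rw [← Nat.card_congr e, hcard]
  have := Nat.card_units K
  have hpos : 0 < Nat.card K := Nat.card_pos
  congr 1
  rw [this]
  omega

/-- Cyclic groups of all orders `n + 1` prescribe the values at the infinitely many integers `n +
2`. -/
theorem IsCountingFunction.unique {𝒳 : MR.{u} ⥤ Type u} {N N' : ℤ[X]}
    (h : IsCountingFunction 𝒳 N) (h' : IsCountingFunction 𝒳 N') : N = N' := by
  refine Polynomial.eq_of_infinite_eval_eq N N' (Set.infinite_of_injective_forall_mem
    (f := fun n : ℕ => ((n + 1 : ℕ) : ℤ) + 1) (fun a b hab => by simpa using hab) fun n => ?_)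
  have hc : Nat.card (ULift.{u} (Multiplicative (ZMod (n + 1)))) = n + 1 := by
    rw [Nat.card_congr Equiv.ulift]
    exact Nat.card_zmod (n + 1)
  have : IsCyclic (ULift.{u} (Multiplicative (ZMod (n + 1)))) :=
    isCyclic_of_surjective (MulEquiv.ulift.symm :
      Multiplicative (ZMod (n + 1)) ≃* ULift.{u} (Multiplicative (ZMod (n + 1))))
      MulEquiv.ulift.symm.surjective
  have h1 := (h.m0 (ULift.{u} (Multiplicative (ZMod (n + 1))))).2
  have h2 := (h'.m0 (ULift.{u} (Multiplicative (ZMod (n + 1))))).2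
  rw [hc] at h1 h2
  exact h1.symm.trans h2

/-! ### Integrality of the Möbius transform -/

/-- The Möbius transform `∑_{m ∣ n} μ(n/m) a^m`. -/
def mobiusPow (a : ℤ) (n : ℕ) : ℤ :=
  ∑ m ∈ n.divisors, ArithmeticFunction.moebius (n / m) * a ^ m

theorem sum_divisors_mobiusPow (a : ℤ) {n : ℕ} (hn : 0 < n) :
    ∑ d ∈ n.divisors, mobiusPow a d = a ^ n := by
  refine (ArithmeticFunction.sum_eq_iff_sum_mul_moebius_eq (f := mobiusPow a)
    (g := fun n => a ^ n)).2 (fun n _ => ?_) n hn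
  rw [mobiusPow, ← Nat.sum_divisorsAntidiagonal' (fun i j =>
    (ArithmeticFunction.moebius i : ℤ) * a ^ j)]
  simp

/-- Fermat's little theorem for `a ^ m`; each further `p`-th power of a congruence gains one factor
`p`. -/
theorem prime_pow_dvd_pow_sub_pow {p : ℕ} (hp : p.Prime) (a : ℤ) (k m : ℕ) :
    (p : ℤ) ^ (k + 1) ∣ a ^ (p ^ (k + 1) * m) - a ^ (p ^ k * m) := by
  have : Fact p.Prime := ⟨hp⟩
  have h : (p : ℤ) ∣ (a ^ m) ^ p - a ^ m := by
    rw [← ZMod.intCast_zmod_eq_zero_iff_dvd]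
    push_cast
    rw [ZMod.pow_card, sub_self]
  have := dvd_sub_pow_of_dvd_sub h k
  rw [← pow_mul, ← pow_mul, ← pow_mul] at this
  rwa [show p ^ (k + 1) * m = m * (p * p ^ k) by ring, mul_comm (p ^ k) m]

/-- Strong induction on the part `m` prime to `p`: summed over the divisors of `p^(k+1) m` that do
not divide `p^k m`, the Möbius transforms give a difference of powers divisible by `p^(k+1)`, and
all but the top term are covered by induction. -/
theorem prime_pow_dvd_mobiusPow {p : ℕ} (hp : p.Prime) (a : ℤ) (k m : ℕ) (hm : ¬p ∣ m) :
    (p : ℤ) ^ (k + 1) ∣ mobiusPow a (p ^ (k + 1) * m) := by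
  induction m using Nat.strong_induction_on with
  | _ m ih =>
  have hm0 : 0 < m := Nat.pos_of_ne_zero fun h => hm (h ▸ dvd_zero p)
  have hn0 : 0 < p ^ (k + 1) * m := Nat.mul_pos (pow_pos hp.pos _) hm0
  have hn0' : 0 < p ^ k * m := Nat.mul_pos (pow_pos hp.pos _) hm0
  have hdvd : p ^ k * m ∣ p ^ (k + 1) * m := Nat.mul_dvd_mul_right (pow_dvd_pow p k.le_succ) m
  have hsub := Nat.divisors_subset_of_dvd hn0.ne' hdvd
  have hmem : p ^ (k + 1) * m ∈ (p ^ (k + 1) * m).divisors \ (p ^ k * m).divisors := by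
    rw [Finset.mem_sdiff, Nat.mem_divisors, Nat.mem_divisors]
    refine ⟨⟨dvd_rfl, hn0.ne'⟩, fun h => ?_⟩
    have := Nat.le_of_dvd hn0' h.1
    exact absurd (Nat.le_of_mul_le_mul_right this hm0)
      (not_le.2 (Nat.pow_lt_pow_right hp.one_lt k.lt_succ_self))
  have hsum := prime_pow_dvd_pow_sub_pow hp a k m
  rw [← sum_divisors_mobiusPow a hn0, ← sum_divisors_mobiusPow a hn0',
    ← Finset.sum_sdiff hsub, add_sub_cancel_right, ← Finset.sum_erase_add _ _ hmem] at hsum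
  refine (dvd_add_right (Finset.dvd_sum fun d hd => ?_)).1 hsum
  obtain ⟨hne, hd⟩ := Finset.mem_erase.1 hd
  rw [Finset.mem_sdiff, Nat.mem_divisors, Nat.mem_divisors] at hd
  obtain ⟨⟨⟨e, he⟩, -⟩, hd2⟩ := hd
  -- If `p` divided the cofactor `e`, then `d` would divide `p^k m`. Hence `d` carries the full
  -- power `p^(k+1)` and equals `p^(k+1) d'` with `d' ∣ m`.
  have hpe : ¬p ∣ e := by
    rintro ⟨e', rfl⟩
    refine hd2 ⟨⟨e', ?_⟩, hn0'.ne'⟩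
    apply Nat.eq_of_mul_eq_mul_left hp.pos
    calc p * (p ^ k * m) = p ^ (k + 1) * m := by ring
      _ = p * (d * e') := by rw [he]; ring
  have hcop : Nat.Coprime (p ^ (k + 1)) e := Nat.Coprime.pow_left _ ((hp.coprime_iff_not_dvd).2 hpe)
  obtain ⟨d', rfl⟩ : p ^ (k + 1) ∣ d := hcop.dvd_of_dvd_mul_right ⟨m, he.symm⟩
  have hm' : m = d' * e := by
    apply Nat.eq_of_mul_eq_mul_left (pow_pos hp.pos (k + 1))
    rw [he, mul_assoc]
  refine ih d' (lt_of_le_of_ne (Nat.le_of_dvd hm0 ⟨e, hm'⟩) fun h => hne (by rw [h])) fun h => ?_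
  exact hm (hm' ▸ h.mul_right e)

/-- The Gauss congruence. -/
theorem dvd_mobiusPow (a : ℤ) {n : ℕ} (hn : 0 < n) : (n : ℤ) ∣ mobiusPow a n := by
  rw [Int.natCast_dvd, Nat.dvd_iff_prime_pow_dvd_dvd]
  intro p k hp hk
  obtain ⟨v, m, hm, rfl⟩ := Nat.exists_eq_pow_mul_and_not_dvd hn.ne' p hp.ne_one
  rcases v with _ | v
  · rcases k with _ | k
    · simp
    · exact absurd ((dvd_pow_self p k.succ_ne_zero).trans (by simpa using hk)) hm
  · have hkv : k ≤ v + 1 := by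
      by_contra hlt
      have h1 := (pow_dvd_pow p (not_le.1 hlt)).trans hk
      rw [pow_succ p (v + 1)] at h1
      exact hm (Nat.dvd_of_mul_dvd_mul_left (pow_pos hp.pos (v + 1)) h1)
    refine (pow_dvd_pow p hkv).trans ?_
    rw [← Int.natCast_dvd]
    push_cast
    exact prime_pow_dvd_mobiusPow hp a v m hm

/-- `κ_a(n)` as an integer. -/
def kappaInt (a : ℤ) (n : ℕ) : ℤ := mobiusPow a n / n

theorem mul_kappaInt (a : ℤ) {n : ℕ} (hn : 0 < n) : n * kappaInt a n = mobiusPow a n :=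
  Int.mul_ediv_cancel' (dvd_mobiusPow a hn)

theorem coe_kappaInt (a : ℤ) {n : ℕ} (hn : 0 < n) : (kappaInt a n : ℚ) = kappa a n := by
  have h : ((n * kappaInt a n : ℤ) : ℚ) = mobiusPow a n := by rw [mul_kappaInt a hn]
  have hn' : (n : ℚ) ≠ 0 := Nat.cast_ne_zero.2 hn.ne'
  rw [kappa, one_div, eq_inv_mul_iff_mul_eq₀ hn']
  rw [mobiusPow] at h
  push_cast at h
  exact h

theorem sum_divisors_mul_kappaInt (a : ℤ) {n : ℕ} (hn : 0 < n) :
    ∑ d ∈ n.divisors, d * kappaInt a d = a ^ n := by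
  rw [← sum_divisors_mobiusPow a hn]
  exact Finset.sum_congr rfl fun d hd => mul_kappaInt a (Nat.pos_of_mem_divisors hd)

/-- There are at most `n` divisors, each contributing at most `a^n`; this cancels the factor `n`.
The bound controls the double series behind the cyclotomic identity. -/
theorem abs_kappaInt_le (a : ℕ) {n : ℕ} (hn : 0 < n) : |kappaInt a n| ≤ (a : ℤ) ^ n := by
  have hn' : (0 : ℤ) < n := by exact_mod_cast hn
  refine le_of_mul_le_mul_left ?_ hn'
  rw [← abs_of_pos hn', ← abs_mul, abs_of_pos hn', mul_kappaInt _ hn]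
  calc |mobiusPow a n| ≤ ∑ m ∈ n.divisors, |ArithmeticFunction.moebius (n / m) * (a : ℤ) ^ m| :=
        Finset.abs_sum_le_sum_abs _ _
    _ ≤ ∑ m ∈ n.divisors, (a : ℤ) ^ n := Finset.sum_le_sum fun m hm => by
        have hm1 := Nat.pos_of_mem_divisors hm
        have hmn := Nat.divisor_le hm
        rw [abs_mul, abs_of_nonneg (by positivity : (0 : ℤ) ≤ (a : ℤ) ^ m)]
        calc _ ≤ 1 * (a : ℤ) ^ m := by
              gcongr
              exact ArithmeticFunction.abs_moebius_le_one
          _ ≤ (a : ℤ) ^ n := by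
              rw [one_mul]
              -- Powers of `0` are not monotone in general, but here both exponents are positive.
              rcases Nat.eq_zero_or_pos a with rfl | ha
              · rw [Nat.cast_zero, zero_pow hm1.ne', zero_pow hn.ne']
              · exact pow_le_pow_right₀ (by exact_mod_cast ha) hmn
    _ ≤ n * (a : ℤ) ^ n := by
        rw [Finset.sum_const, nsmul_eq_mul]
        gcongr
        exact Nat.card_divisors_le_self n

theorem kappaInt_zero {n : ℕ} (hn : 0 < n) : kappaInt 0 n = 0 := by
  have := abs_kappaInt_le 0 hn
  rw [Nat.cast_zero, zero_pow hn.ne'] at this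
  exact abs_eq_zero.1 (le_antisymm this (abs_nonneg _))

/-- The number `M_n(N)` as an integer. -/
def mobiusInt (N : ℤ[X]) (n : ℕ) : ℤ := ∑ a ∈ N.support, N.coeff a * kappaInt a n

theorem coe_mobiusInt (N : ℤ[X]) {n : ℕ} (hn : 0 < n) :
    (mobiusInt N n : ℚ) = mobiusValue n (linearMobius n N) := by
  rw [linearMobius, Polynomial.lsum_apply, Polynomial.sum, map_sum, mobiusInt]
  push_cast
  refine Finset.sum_congr rfl fun a _ => ?_
  rw [LinearMap.toSpanSingleton_apply, map_smul, mobiusValue, DirectSum.coeLinearMap_lof,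
    zsmul_eq_mul, coe_kappaInt _ hn]

/-! ### The absolute zeta function -/

theorem zpow_sum {ι K : Type*} [Field K] {x : K} (hx : x ≠ 0) (s : Finset ι) (c : ι → ℤ) :
    x ^ (∑ i ∈ s, c i) = ∏ i ∈ s, x ^ c i := by
  classical
  induction s using Finset.induction_on with
  | empty => simp
  | insert i s hi ih => rw [Finset.sum_insert hi, Finset.prod_insert hi, zpow_add₀ hx, ih]

theorem eval_one_eq_sum (N : ℤ[X]) : N.eval 1 = ∑ a ∈ N.support, N.coeff a := by
  rw [Polynomial.eval_eq_sum, Polynomial.sum]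
  simp

/-- The function `∏_a (s - a)^{-c_a}` for `N = ∑ c_a t^a`. -/
def zetaProd (N : ℤ[X]) (s : ℂ) : ℂ := ∏ a ∈ N.support, (s - a) ^ (-N.coeff a)

/-- Each factor is in normal form, and at any point at most one of them vanishes there, because the
numbers `a` are distinct. A pole takes the value `0` because `0` to a negative power is `0`. -/
theorem meromorphicNFOn_zetaProd (N : ℤ[X]) : MeromorphicNFOn (zetaProd N) Set.univ := by
  intro s _
  refine meromorphicNFAt_fun_prod (f := fun (a : ℕ) (s : ℂ) => (s - a) ^ (-N.coeff a))
    (fun a _ => ?_) ?_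
  · have h : AnalyticAt ℂ (fun s : ℂ => s - a) s := by fun_prop
    exact h.meromorphicNFAt.zpow
  · rintro a ⟨-, ha⟩ b ⟨-, hb⟩
    have ha' := sub_eq_zero.1 (eq_zero_of_zpow_eq_zero ha)
    have hb' := sub_eq_zero.1 (eq_zero_of_zpow_eq_zero hb)
    exact Nat.cast_injective (R := ℂ) (ha'.symm.trans hb')

/-! ### Logarithmic series and the limit `p → 1` -/

theorem hasSum_pnat_pow_div (z : ℂ) (hz : ‖z‖ < 1) :
    HasSum (fun n : ℕ+ => z ^ (n : ℕ) / (n : ℕ)) (-Complex.log (1 - z)) := by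
  refine (PNat.coe_injective.hasSum_iff (f := fun n : ℕ => z ^ n / n) fun n hn => ?_).2
    (Complex.hasSum_taylorSeries_neg_log hz)
  -- Index `0`, absent from `ℕ+`, contributes `z ^ 0 / 0 = 0`.
  rcases Nat.eq_zero_or_pos n with rfl | h
  · simp
  · exact absurd ⟨⟨n, h⟩, rfl⟩ hn

theorem hasSum_pnat_pow_div_real (z : ℝ) (hz : |z| < 1) :
    HasSum (fun n : ℕ+ => z ^ (n : ℕ) / (n : ℕ)) (-Real.log (1 - z)) := by
  have h := hasSum_pnat_pow_div z (by rwa [Complex.norm_real])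
  rw [← Complex.hasSum_ofReal]
  have h1 : (0 : ℝ) ≤ 1 - z := by linarith [le_abs_self z]
  push_cast [Complex.ofReal_log h1]
  exact h

theorem zetaTerm_eq (N : ℤ[X]) {p : ℝ} (hp : 1 < p) (s : ℝ) (m : ℕ+) :
    zetaTerm N p s m =
      ∑ a ∈ N.support, (N.coeff a : ℝ) * ((p ^ ((a : ℝ) - s)) ^ (m : ℕ) / (m : ℕ)) := by
  have hp0 : 0 < p := one_pos.trans hp
  rw [zetaTerm, Polynomial.eval_map, Polynomial.eval₂_eq_sum, Polynomial.sum, Finset.sum_div,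
    Finset.sum_mul]
  refine Finset.sum_congr rfl fun a _ => ?_
  rw [Real.rpow_mul hp0.le, Real.rpow_natCast, sub_eq_add_neg, Real.rpow_add hp0,
    Real.rpow_natCast, mul_pow, ← pow_mul, ← pow_mul, mul_comm (m : ℕ) a, eq_intCast]
  ring

theorem lt_of_mem_support {N : ℤ[X]} {s : ℝ} (hs : (N.natDegree : ℝ) < s) {a : ℕ}
    (ha : a ∈ N.support) : (a : ℝ) < s :=
  lt_of_le_of_lt (Nat.cast_le.2 (Polynomial.le_natDegree_of_mem_supp a ha)) hs

theorem rpow_sub_lt_one {p s a : ℝ} (hp : 1 < p) (ha : a < s) : p ^ (a - s) < 1 :=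
  Real.rpow_lt_one_of_one_lt_of_neg hp (sub_neg.2 ha)

theorem hasSum_zetaTerm (N : ℤ[X]) {p s : ℝ} (hp : 1 < p) (hs : (N.natDegree : ℝ) < s) :
    HasSum (zetaTerm N p s)
      (∑ a ∈ N.support, (N.coeff a : ℝ) * -Real.log (1 - p ^ ((a : ℝ) - s))) := by
  rw [funext (zetaTerm_eq N hp s)]
  refine hasSum_sum fun a ha => (hasSum_pnat_pow_div_real _ ?_).mul_left _
  rw [abs_of_pos (Real.rpow_pos_of_pos (one_pos.trans hp) _)]
  exact rpow_sub_lt_one hp (lt_of_mem_support hs ha)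

/-- `N(1)` is the sum of the coefficients, so `(p - 1)^N(1)` distributes as one power `(p - 1)^c_a`
per factor `(1 - p^(a-s))^(-c_a)`. -/
theorem zpow_mul_exp_tsum_zetaTerm (N : ℤ[X]) {p s : ℝ} (hp : 1 < p)
    (hs : (N.natDegree : ℝ) < s) :
    (p - 1) ^ (N.eval 1) * Real.exp (∑' m, zetaTerm N p s m) =
      ∏ a ∈ N.support, ((1 - p ^ ((a : ℝ) - s)) / (p - 1)) ^ (-N.coeff a) := by
  rw [(hasSum_zetaTerm N hp hs).tsum_eq, Real.exp_sum, eval_one_eq_sum,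
    zpow_sum (sub_pos.2 hp).ne', ← Finset.prod_mul_distrib]
  refine Finset.prod_congr rfl fun a ha => ?_
  have h1 := sub_pos.2 (rpow_sub_lt_one hp (lt_of_mem_support hs ha))
  rw [mul_comm (N.coeff a : ℝ), Real.exp_mul, Real.rpow_intCast, Real.exp_neg, Real.exp_log h1,
    inv_zpow', div_zpow, zpow_neg (p - 1),
    div_inv_eq_mul, mul_comm]

/-- The quotient is minus the slope at `1` of `p ↦ p^(a-s)`, whose derivative there is `a - s`. -/
theorem tendsto_one_sub_rpow_div (a s : ℝ) :
    Tendsto (fun p : ℝ => (1 - p ^ (a - s)) / (p - 1)) (𝓝[>] 1) (𝓝 (s - a)) := by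
  have h : HasDerivAt (fun p : ℝ => p ^ (a - s)) (a - s) 1 := by
    simpa using Real.hasDerivAt_rpow_const (x := 1) (p := a - s) (Or.inl one_ne_zero)
  have h' := (hasDerivAt_iff_tendsto_slope.1 h).mono_left
    (nhdsWithin_mono 1 fun x (hx : 1 < x) => hx.ne')
  rw [← neg_sub a s]
  refine h'.neg.congr fun p => ?_
  rw [slope_def_field, Real.one_rpow, ← neg_div, neg_sub]

theorem isAbsoluteZeta_zetaProd (N : ℤ[X]) : IsAbsoluteZeta N (zetaProd N) where
  meromorphic := meromorphicNFOn_zetaProd N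
  summable _ hs _ hp := (hasSum_zetaTerm N hp hs).summable
  limit s hs := by
    have h : Tendsto (fun p : ℝ => ∏ a ∈ N.support,
        ((1 - p ^ ((a : ℝ) - s)) / (p - 1)) ^ (-N.coeff a)) (𝓝[>] 1)
        (𝓝 (∏ a ∈ N.support, (s - a) ^ (-N.coeff a))) :=
      tendsto_finsetProd _ fun a ha => (tendsto_one_sub_rpow_div a s).zpow₀ _
        (Or.inl (sub_pos.2 (lt_of_mem_support hs ha)).ne')
    have h' := (Complex.continuous_ofReal.tendsto _).comp h
    have e : ((∏ a ∈ N.support, (s - a) ^ (-N.coeff a) : ℝ) : ℂ) = zetaProd N s := by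
      rw [zetaProd]
      push_cast
      rfl
    rw [e] at h'
    refine h'.congr' ?_
    filter_upwards [self_mem_nhdsWithin] with p hp
    rw [zpow_mul_exp_tsum_zetaTerm N hp hs]
    rfl

/-- Identity theorem: the limits agree on a real ray, which has accumulation points, so the
difference has infinite order at one point and hence everywhere. Normal form then fixes the values
at the poles. -/
theorem IsAbsoluteZeta.unique {N : ℤ[X]} {ζ ζ' : ℂ → ℂ} (h : IsAbsoluteZeta N ζ)
    (h' : IsAbsoluteZeta N ζ') : ζ = ζ' := by
  have hreal : ∀ s : ℝ, (N.natDegree : ℝ) < s → ζ s = ζ' s := fun s hs =>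
    tendsto_nhds_unique (h.limit s hs) (h'.limit s hs)
  have hm : Meromorphic (ζ - ζ') := fun z =>
    (h.meromorphic (Set.mem_univ z)).meromorphicAt.sub (h'.meromorphic (Set.mem_univ z)).meromorphicAt
  -- Any real point beyond the degree serves; it is approached from the right along reals where both
  -- functions are the same limit.
  let x : ℝ := N.natDegree + 1
  have hx : Tendsto (fun s : ℝ => (s : ℂ)) (𝓝[>] x) (𝓝[≠] (x : ℂ)) := by
    refine tendsto_nhdsWithin_iff.2 ⟨(Complex.continuous_ofReal.tendsto x).mono_left
      nhdsWithin_le_nhds, ?_⟩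
    filter_upwards [self_mem_nhdsWithin] with s hs
    exact fun e => (ne_of_gt hs) (Complex.ofReal_injective e)
  have hfreq : ∃ᶠ z in 𝓝[≠] (x : ℂ), (ζ - ζ') z = 0 := by
    refine hx.frequently (Eventually.frequently ?_)
    filter_upwards [self_mem_nhdsWithin] with s hs
    exact sub_eq_zero.2 (hreal s ((lt_add_one _).trans hs))
  have htop : meromorphicOrderAt (ζ - ζ') x = ⊤ :=
    meromorphicOrderAt_eq_top_iff.2 ((hm x).frequently_zero_iff_eventuallyEq_zero.1 hfreq)
  have hall : ∀ z, meromorphicOrderAt (ζ - ζ') z = ⊤ := by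
    by_contra hc
    push Not at hc
    exact hm.exists_meromorphicOrderAt_ne_top_iff_forall.1 hc x htop
  funext z
  have hz : ζ =ᶠ[𝓝[≠] z] ζ' := by
    filter_upwards [meromorphicOrderAt_eq_top_iff.1 (hall z)] with w hw
    exact sub_eq_zero.1 hw
  exact (((h.meromorphic (Set.mem_univ z)).eventuallyEq_nhdsNE_iff_eventuallyEq_nhds
    (h'.meromorphic (Set.mem_univ z))).1 hz).eq_of_nhds

/-! ### The product expansion -/

section product

variable (a : ℕ) {x : ℂ}

/-- Since `n j ≥ n + (j - 1)` for `n, j ≥ 1`, the term is bounded by `‖a x‖^n ‖x‖^(j-1)`, a product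
of two geometric series. Absolute convergence licenses the rearrangement in
`hasSum_kappaInt_mul_log`. -/
theorem summable_kappaInt_mul_pow (hx : ‖x‖ < 1) (hax : ‖a * x‖ < 1) :
    Summable fun c : ℕ+ × ℕ+ =>
      (kappaInt a c.1 : ℂ) * ((x ^ (c.1 : ℕ)) ^ (c.2 : ℕ) / (c.2 : ℕ)) := by
  have h1 : Summable fun n : ℕ+ => ‖(a : ℂ) * x‖ ^ (n : ℕ) :=
    (summable_geometric_of_lt_one (norm_nonneg _) hax).comp_injective PNat.coe_injective
  have h2 : Summable fun j : ℕ+ => ‖x‖ ^ ((j : ℕ) - 1) :=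
    (summable_geometric_of_lt_one (norm_nonneg _) hx).comp_injective
      (i := fun j : ℕ+ => (j : ℕ) - 1) PNat.natPred_injective
  refine Summable.of_norm_bounded (h1.mul_of_nonneg h2 (fun _ => by positivity)
    fun _ => by positivity) fun c => ?_
  obtain ⟨n, j⟩ := c
  have hk : ‖(kappaInt a n : ℂ)‖ ≤ (a : ℝ) ^ (n : ℕ) := by
    rw [Complex.norm_intCast]
    exact_mod_cast abs_kappaInt_le a n.pos
  have hj : (1 : ℝ) ≤ (j : ℕ) := by exact_mod_cast j.pos
  rw [norm_mul, norm_div, norm_pow, norm_pow, norm_mul, Complex.norm_natCast,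
    Complex.norm_natCast, mul_pow, mul_assoc, ← pow_add, ← pow_mul]
  refine mul_le_mul hk ?_ (by positivity) (by positivity)
  refine (div_le_self (by positivity) hj).trans ?_
  refine pow_le_pow_of_le_one (norm_nonneg _) hx.le ?_
  have hn1 := n.pos
  have hj1 := j.pos
  obtain ⟨i, hi⟩ : ∃ i, (j : ℕ) = i + 1 := ⟨(j : ℕ) - 1, by omega⟩
  rw [hi, Nat.add_sub_cancel]
  nlinarith

/-- The logarithm of the cyclotomic identity. -/
theorem hasSum_kappaInt_mul_log (hx : ‖x‖ < 1) (hax : ‖a * x‖ < 1) :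
    HasSum (fun n : ℕ+ => (kappaInt a n : ℂ) * -Complex.log (1 - x ^ (n : ℕ)))
      (-Complex.log (1 - a * x)) := by
  have hs := (summable_kappaInt_mul_pow a hx hax).hasSum
  -- Summing over `j` first gives the logarithms of `1 - x^n`.
  have hrow := hs.prod_fiberwise fun n => (hasSum_pnat_pow_div (x ^ (n : ℕ))
    (by rw [norm_pow]; exact pow_lt_one₀ (norm_nonneg _) hx n.ne_zero)).mul_left
      (kappaInt a n : ℂ)
  -- Grouping by `m = n j` instead, the coefficient of `x^m / m` is `∑_{n ∣ m} n κ_a(n) = a^m`.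
  have hdiag := (sigmaAntidiagonalEquivProd.hasSum_iff.2 hs).sigma
    (g := fun m : ℕ+ => (a * x) ^ (m : ℕ) / (m : ℕ)) fun m => by
      suffices h : ∑ y : (m : ℕ).divisorsAntidiagonal, ((fun c : ℕ+ × ℕ+ =>
          (kappaInt a c.1 : ℂ) * ((x ^ (c.1 : ℕ)) ^ (c.2 : ℕ) / (c.2 : ℕ))) ∘
          sigmaAntidiagonalEquivProd) ⟨m, y⟩ = (a * x) ^ (m : ℕ) / (m : ℕ) from
        h ▸ hasSum_fintype _
      have hm : ((m : ℕ) : ℂ) ≠ 0 := Nat.cast_ne_zero.2 m.ne_zero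
      simp only [Function.comp_apply, sigmaAntidiagonalEquivProd, divisorsAntidiagonalFactors,
        Equiv.coe_fn_mk, PNat.mk_coe, Finset.univ_eq_attach]
      rw [Finset.sum_attach (m : ℕ).divisorsAntidiagonal fun y : ℕ × ℕ =>
        (kappaInt a y.1 : ℂ) * ((x ^ y.1) ^ y.2 / (y.2 : ℂ))]
      have key : ∀ y ∈ (m : ℕ).divisorsAntidiagonal,
          (kappaInt a y.1 : ℂ) * ((x ^ y.1) ^ y.2 / (y.2 : ℂ)) =
            (y.1 * kappaInt a y.1 : ℂ) * (x ^ (m : ℕ) / (m : ℕ)) := fun y hy => by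
        obtain ⟨hy, -⟩ := Nat.mem_divisorsAntidiagonal.1 hy
        rw [← pow_mul, hy]
        have h2 : (y.1 : ℂ) * y.2 = (m : ℕ) := by rw [← Nat.cast_mul, hy]
        rw [← h2] at hm ⊢
        have := left_ne_zero_of_mul hm
        have := right_ne_zero_of_mul hm
        field_simp
      rw [Finset.sum_congr rfl key, ← Finset.sum_mul,
        Nat.sum_divisorsAntidiagonal (fun i _ => (i * kappaInt a i : ℂ))]
      have hsum : ∑ i ∈ (m : ℕ).divisors, (i * kappaInt a i : ℂ) = (a : ℂ) ^ (m : ℕ) := by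
        exact_mod_cast congrArg (Int.cast : ℤ → ℂ) (sum_divisors_mul_kappaInt a m.pos)
      rw [hsum, mul_pow, mul_div_assoc]
  rwa [hdiag.unique (hasSum_pnat_pow_div _ hax)] at hrow

end product

theorem summable_norm_exp_sub_one {ι : Type*} {f : ι → ℂ} (hf : Summable f) :
    Summable fun i => ‖Complex.exp (f i) - 1‖ := by
  refine Summable.of_norm_bounded_eventually ((hf.norm).mul_left 2) ?_
  -- The bound `‖exp z - 1‖ ≤ 2 ‖z‖` needs `‖z‖ ≤ 1`, which fails for finitely many indices at most.
  have : ∀ᶠ i in cofinite, ‖f i‖ < 1 :=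
    (hf.norm.tendsto_cofinite_zero).eventually (gt_mem_nhds one_pos)
  filter_upwards [this] with i hi
  rw [norm_norm]
  exact Complex.norm_exp_sub_one_le hi.le

/-- Exponentiate the integer combination, with the coefficients of `N`, of the logarithmic
cyclotomic identities. Integer exponents make the choice of branch irrelevant. -/
theorem hasProd_of_norm_lt_one (N : ℤ[X]) {x : ℂ} (hx : ‖x‖ < 1)
    (hN : ∀ a ∈ N.support, ‖(a : ℂ) * x‖ < 1) :
    Summable (fun n : ℕ+ => ‖(1 - x ^ (n : ℕ)) ^ (-mobiusInt N n) - 1‖) ∧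
    HasProd (fun n : ℕ+ => (1 - x ^ (n : ℕ)) ^ (-mobiusInt N n))
      (∏ a ∈ N.support, (1 - a * x) ^ (-N.coeff a)) := by
  have hne : ∀ {z : ℂ}, ‖z‖ < 1 → 1 - z ≠ 0 := fun {z} hz h => by
    rw [← sub_eq_zero.1 h, norm_one] at hz
    exact lt_irrefl _ hz
  have hexp : ∀ {z : ℂ} (_ : ‖z‖ < 1) (c : ℤ),
      Complex.exp (c * -Complex.log (1 - z)) = (1 - z) ^ (-c) := fun {z} hz c => by
    rw [Complex.exp_int_mul, Complex.exp_neg, Complex.exp_log (hne hz), inv_zpow']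
  have hsum : HasSum (fun n : ℕ+ => (mobiusInt N n : ℂ) * -Complex.log (1 - x ^ (n : ℕ)))
      (∑ a ∈ N.support, (N.coeff a : ℂ) * -Complex.log (1 - a * x)) := by
    refine (hasSum_sum fun a ha =>
      (hasSum_kappaInt_mul_log a hx (hN a ha)).mul_left (N.coeff a : ℂ)).congr_fun fun n => ?_
    rw [mobiusInt]
    push_cast
    rw [Finset.sum_mul]
    exact Finset.sum_congr rfl fun a _ => mul_assoc _ _ _
  have hterm : ∀ n : ℕ+, Complex.exp ((mobiusInt N n : ℂ) * -Complex.log (1 - x ^ (n : ℕ))) =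
      (1 - x ^ (n : ℕ)) ^ (-mobiusInt N n) := fun n =>
    hexp (by rw [norm_pow]; exact pow_lt_one₀ (norm_nonneg _) hx n.ne_zero) _
  constructor
  · refine (summable_norm_exp_sub_one hsum.summable).congr fun n => ?_
    rw [hterm]
  · have h := hsum.cexp
    rw [Complex.exp_sum, Finset.prod_congr rfl fun a ha => hexp (hN a ha) (N.coeff a)] at h
    exact h.congr_fun fun n => (hterm n).symm

theorem hasProd_mobiusInt (N : ℤ[X]) {s : ℂ} (hs : (N.natDegree : ℝ) < ‖s‖) :
    Summable (fun n : ℕ+ => ‖(1 - (1 / s) ^ (n : ℕ)) ^ (-mobiusInt N n) - 1‖) ∧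
    HasProd (fun n : ℕ+ => (1 - (1 / s) ^ (n : ℕ)) ^ (-mobiusInt N n))
      (∏ a ∈ N.support, (1 - a * (1 / s)) ^ (-N.coeff a)) := by
  have hs0 : 0 < ‖s‖ := (Nat.cast_nonneg _).trans_lt hs
  -- For constant `N` the assumption only says `s ≠ 0`, and `1/s` may lie outside the unit disc.
  -- Then every exponent vanishes because `κ_0(n) = 0`, and the product is trivially `1`. In
  -- positive degree `‖s‖ > 1`.
  rcases Nat.eq_zero_or_pos N.natDegree with hd | hd
  · have ha : ∀ a ∈ N.support, a = 0 := fun a ha =>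
      Nat.le_zero.1 (hd ▸ Polynomial.le_natDegree_of_mem_supp a ha)
    have hz : ∀ n : ℕ+, mobiusInt N n = 0 := fun n => Finset.sum_eq_zero fun a h => by
      rw [ha a h, Nat.cast_zero, kappaInt_zero n.pos, mul_zero]
    have hp : ∏ a ∈ N.support, (1 - a * (1 / s)) ^ (-N.coeff a) = 1 :=
      Finset.prod_eq_one fun a h => by rw [ha a h, Nat.cast_zero, zero_mul, sub_zero, one_zpow]
    simp only [hz, hp, neg_zero, zpow_zero, sub_self, norm_zero]
    exact ⟨summable_zero, hasProd_one⟩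
  · refine hasProd_of_norm_lt_one N ?_ fun a ha => ?_
    · rw [norm_div, norm_one, div_lt_one hs0]
      exact (Nat.one_le_cast.2 hd).trans_lt hs
    · rw [mul_one_div, norm_div, div_lt_one hs0, Complex.norm_natCast]
      exact lt_of_mem_support hs ha

/-- Pull `s` out of every factor: `s - a = s (1 - a/s)`, and the exponents of `1/s` add up to
`N(1)`. -/
theorem zetaProd_eq (N : ℤ[X]) {s : ℂ} (hs : s ≠ 0) :
    zetaProd N s = (1 / s) ^ (N.eval 1) * ∏ a ∈ N.support, (1 - a * (1 / s)) ^ (-N.coeff a) := by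
  rw [eval_one_eq_sum, zpow_sum (one_div_ne_zero hs), ← Finset.prod_mul_distrib, zetaProd]
  refine Finset.prod_congr rfl fun a _ => ?_
  rw [one_div, inv_zpow', ← mul_zpow]
  congr 1
  field_simp

end FOne

end

/-! ### The theorem -/

theorem mainTheorem2 (𝒳 : FOne.MR.{u} ⥤ Type u) (h𝒳 : FOne.IsF1Scheme 𝒳)
    (hN : FOne.IsNoetherian 𝒳) (ht : FOne.IsTorsionFree 𝒳) :
    (∃! N : ℤ[X], FOne.IsCountingFunction 𝒳 N) ∧
    ∀ N : ℤ[X], FOne.IsCountingFunction 𝒳 N →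
      (∃! ζ : ℂ → ℂ, FOne.IsAbsoluteZeta N ζ) ∧
      ∀ ζ : ℂ → ℂ, FOne.IsAbsoluteZeta N ζ →
        ∃ κ : ℕ+ → ℤ,
          (∀ n : ℕ+, (κ n : ℚ) = FOne.mobiusValue n (FOne.linearMobius n N)) ∧
          ∀ s : ℂ, (N.natDegree : ℝ) < ‖s‖ →
            Summable (fun n : ℕ+ => ‖(1 - (1 / s) ^ (n : ℕ)) ^ (-κ n) - 1‖) ∧
            Multipliable (fun n : ℕ+ => (1 - (1 / s) ^ (n : ℕ)) ^ (-κ n)) ∧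
            ζ s = (1 / s) ^ (N.eval 1) * ∏' n : ℕ+, (1 - (1 / s) ^ (n : ℕ)) ^ (-κ n) := by
  obtain ⟨N₀, hN₀⟩ := FOne.exists_isCountingFunction 𝒳 h𝒳 hN ht
  refine ⟨⟨N₀, hN₀, fun N hN' => hN'.unique hN₀⟩, fun N _ => ⟨⟨FOne.zetaProd N,
    FOne.isAbsoluteZeta_zetaProd N, fun ζ hζ => hζ.unique (FOne.isAbsoluteZeta_zetaProd N)⟩,
    fun ζ hζ => ⟨fun n => FOne.mobiusInt N n, fun n => FOne.coe_mobiusInt N n.pos,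
      fun s hs => ?_⟩⟩⟩
  obtain ⟨hsum, hprod⟩ := FOne.hasProd_mobiusInt N hs
  have hs0 : s ≠ 0 := norm_pos_iff.1 ((Nat.cast_nonneg _).trans_lt hs)
  refine ⟨hsum, hprod.multipliable, ?_⟩
  rw [hζ.unique (FOne.isAbsoluteZeta_zetaProd N), hprod.tprod_eq, FOne.zetaProd_eq N hs0]
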